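/- All graphs are finite and simple. A set $X$ of vertices of a graph $G$ is a biclique of $G$ if the induced subgraph $G[X]$ is a complete bipartite graph with two nonempty sides and $X$ is inclusion-wise maximal with this property. The edge-biclique hypergraph $\mathcal{EB}(G)$ has as its vertices the edges of $G$, and as its hyperedges the edge sets of the graphs $G[X]$, where $X$ runs over the bicliques of $G$. A hypergraph is Helly if every nonempty collection of pairwise intersecting hyperedges has a common element. For a hypergraph $\mathcal H=(V,\mathcal E)$ and $A\subseteq V$, the subhypergraph induced by $A$ is $\mathcal H[A]=(A,\{X\cap A: X\in\mathcal E\}\setminus\{\emptyset\})$; the reduction of a hypergraph keeps all its vertices and only its inclusion-wise maximal hyperedges; and $\mathcal H$ is hereditary Helly if for every $A\subseteq V$ the reduction of $\mathcal H[A]$ is Helly. **Corollary.** The graphs $G$ whose edge-biclique hypergraph $\mathcal{EB}(G)$ is hereditary Helly can be recognized in polynomial time. The graphs $G$ such that $\mathcal{EB}(H)$ is Helly for every induced subgraph $H$ of $G$ can also be recognized in polynomial time. Here a class of graphs can be recognized in polynomial time if there are a Turing machine and a polynomial $p$ such that the machine, given the adjacency matrix of any finite graph $G$ written as a word of length $\ell$,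 halts after at most $p(\ell)$ steps and outputs whether $G$ is in the class. -/

import Mathlib

namespace EdgeBiclique

/-! ### Hypergraphs -/

section Hyper

variable {α : Type*}

/-- The subhypergraph of `H` induced by `A`: its vertex set is `A` and its hyperedges are the
nonempty sets `X ∩ A`, for `X` a hyperedge of `H`. It is used only for `A ⊆ H.vertexSet`. -/
def inducedSubhypergraph (H : Hypergraph α) (A : Set α) : Hypergraph α where
  vertexSet := A
  edgeSet := {Y | Y.Nonempty ∧ ∃ X ∈ H.edgeSet, Y = X ∩ A}
  subset_vertexSet_of_mem_edgeSet' := by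
    rintro Y ⟨-, X, -, rfl⟩
    exact Set.inter_subset_right

/-- The reduction of `H`: the same vertices, only the inclusion-wise maximal hyperedges. -/
def reduction (H : Hypergraph α) : Hypergraph α where
  vertexSet := H.vertexSet
  edgeSet := {X | Maximal (fun Y => Y ∈ H.edgeSet) X}
  subset_vertexSet_of_mem_edgeSet' := fun _ h =>
    H.subset_vertexSet_of_mem_edgeSet' h.prop

/-- `H` is Helly: every nonempty collection of pairwise intersecting hyperedges has a common
element. -/
def IsHelly (H : Hypergraph α) : Prop :=
  ∀ F ⊆ H.edgeSet, F.Nonempty → (∀ X ∈ F, ∀ Y ∈ F, (X ∩ Y).Nonempty) → (⋂₀ F).Nonempty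

/-- `H` is hereditary Helly: the reduction of every induced subhypergraph of `H` is Helly. -/
def IsHereditaryHelly (H : Hypergraph α) : Prop :=
  ∀ A ⊆ H.vertexSet, IsHelly (reduction (inducedSubhypergraph H A))

end Hyper

/-! ### Bicliques -/

section Bicliques

variable {V : Type*} (G : SimpleGraph V)

/-- `G[X]` is a complete bipartite graph (with two nonempty sides `S` and `T`). The sides are
disjoint because every vertex of `S` is adjacent to every vertex of `T`. -/
def InducesCompleteBipartite (X : Set V) : Prop :=
  ∃ S T : Set V, S.Nonempty ∧ T.Nonempty ∧ S ∪ T = X ∧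
    G.IsIndepSet S ∧ G.IsIndepSet T ∧ G.IsCompleteBetween S T

/-- A biclique: an inclusion-wise maximal set that induces a complete bipartite graph. -/
def IsBiclique (X : Set V) : Prop :=
  Maximal (InducesCompleteBipartite G) X

/-- The set of edges of the induced subgraph `G[X]`, as edges of `G`. -/
def inducedEdges (X : Set V) : Set (Sym2 V) :=
  {e | e ∈ G.edgeSet ∧ ∀ v ∈ e, v ∈ X}

/-- The edge-biclique hypergraph of `G`: its vertices are the edges of `G` and its hyperedges are
the edge sets of the bicliques of `G`. -/
def edgeBicliqueHypergraph : Hypergraph (Sym2 V) where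
  vertexSet := G.edgeSet
  edgeSet := {F | ∃ X, IsBiclique G X ∧ F = inducedEdges G X}
  subset_vertexSet_of_mem_edgeSet' := by
    rintro F ⟨X, -, rfl⟩ e he
    exact he.1

end Bicliques

/-! ### Polynomial-time recognition -/

/-- A finite graph with vertices `0, …, n - 1`, as an input of an algorithm. -/
abbrev InputGraph : Type := Σ n : ℕ, SimpleGraph (Fin n)

open Classical in
/-- Adjacency-matrix encoding: the rows of the adjacency matrix are written one after the other,
and each row is closed by the symbol `none`. -/
noncomputable def encodeGraph (G : InputGraph) : List (Option Bool) :=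
  (List.finRange G.1).flatMap fun i =>
    ((List.finRange G.1).map fun j => some (decide (G.2.Adj i j))) ++ [none]

theorem length_encodeGraph (G : InputGraph) : (encodeGraph G).length = G.1 * (G.1 + 1) := by
  simp [encodeGraph, List.length_flatMap]

theorem flatMap_injOn {α β : Type*} (k : ℕ) (l : List α) (f g : α → List β)
    (hf : ∀ a, (f a).length = k) (hg : ∀ a, (g a).length = k)
    (h : l.flatMap f = l.flatMap g) : ∀ a ∈ l, f a = g a := by
  induction l with
  | nil => simp
  | cons b l ih =>
    simp only [List.flatMap_cons] at h
    obtain ⟨h1, h2⟩ := List.append_inj h ((hf b).trans (hg b).symm)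
    intro a ha
    rcases List.mem_cons.1 ha with rfl | ha
    · exact h1
    · exact ih h2 a ha

/-- Different graphs have different encodings. -/
theorem encodeGraph_injective : Function.Injective encodeGraph := by
  rintro ⟨n, G⟩ ⟨m, H⟩ h
  have hl := congrArg List.length h
  simp only [length_encodeGraph] at hl
  obtain rfl : n = m := by nlinarith
  congr 1
  have hr := flatMap_injOn (n + 1) _ _ _ (by simp) (by simp) h
  ext i j
  have hi := hr i (List.mem_finRange i)
  have hj := List.map_inj_left.1 (List.append_cancel_right hi) j (List.mem_finRange j)
  simpa using hj

/-- The property `P` of finite graphs can be recognized in polynomial time: a Turing machine, when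
started on the encoding of a graph `G`, halts after a number of steps bounded by a polynomial in
the length of that encoding, and its output is the bit that tells whether `P G` holds. -/
def RecognizableInPolyTime (P : InputGraph → Prop) : Prop :=
  ∃ f : InputGraph → Bool, (∀ G, f G = true ↔ P G) ∧
    Nonempty (Turing.TM2ComputableInPolyTime encodeGraph Computability.encodeBool f)

end EdgeBiclique

/-! For either class, a finite graph lies outside it exactly when some map from a fixed finite set
into its vertices, not necessarily injective, pulls it back to one of finitely many patterns. With
`k` the size of that set, only `n ^ k` maps have to be tried, and a Turing machine can try them all
(`recognizable_of_not_iff_exists_tuple`).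

Two facts produce the patterns. By Berge's criterion (`exists_triple_of_not_isHelly`), a failure of
the Helly property is witnessed by three vertices of the hypergraph, here three edges `a i` of the
graph. Moreover, whether a set containing an edge `pq` is complete bipartite is a condition on pairs
of its vertices (`inducesCompleteBipartite_iff`). Hence an edge that is compatible with any two of
the `a i` (lies with them in a complete bipartite set) is compatible with all three.

In the hereditary case the pattern adds edges `c i`, where `c i` is compatible with the two `a j`,
`j ≠ i`, but not with all three. Maximality of a trace that avoids `a i` yields `c i`; conversely
the six edges form a bad set `A`.

For induced subgraphs, each edge of the subgraph must be missed by a biclique through two of the `a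
i`. One extra vertex per ordered pair of ends is enough: an edge that meets an extra vertex is never
compatible with all three `a i`, so it calls for no further witness. -/

open Turing Computability

namespace EdgeBiclique
-- The machine that searches through all tuples
namespace TupleSearch

/-- The tapes of the machine: the adjacency matrix `inp` with the part `done` already read, two
copies `row`, `col` of the word that holds the current tuple, with the parts already read, and
the output. -/
inductive Stk
  | inp | done | row | row' | col | col' | out
  deriving DecidableEq

instance : Fintype Stk :=
  ⟨{.inp, .done, .row, .row', .col, .col', .out}, fun s => by cases s <;> simp⟩

/-- A set of indices of a `k`-tuple. -/
abbrev Marks (k : ℕ) : Type := Fin k → Bool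

/-- The alphabets of the tapes. -/
abbrev Alph (k : ℕ) : Stk → Type
  | .inp => Option Bool
  | .done => Option Bool
  | .row => Marks k
  | .row' => Marks k
  | .col => Marks k
  | .col' => Marks k
  | .out => Bool

/-- `setup` builds the zero tuple and `back` rewinds the matrix; `row`, `col`, `unCol`, `unRow`
evaluate `P` at the current tuple; `inc`, `place`, `rest`, `wrap` act as an odometer whose entry `0`
moves fastest; `fin` empties the tapes. -/
inductive Lab (k : ℕ)
  | setup | back | row | col | unCol | unRow | rest | fin
  | inc (t : Fin k)
  | place (t : Fin k)
  | wrap (t : Fin k)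
  deriving Fintype

/-- The finite memory: the symbols read last, the marks of the current row, the part of the
adjacency matrix of the current tuple that is known, and whether a good tuple has been found. -/
structure Mem (k : ℕ) where
  sym : Option (Option Bool) := none
  cell : Option (Marks k) := none
  cur : Marks k := fun _ => false
  acc : Fin k → Fin k → Bool := fun _ _ => false
  found : Bool := false

variable {k : ℕ}

instance : Finite (Mem k) :=
  Finite.of_injective
    (β := Option (Option Bool) × Option (Marks k) × Marks k × (Fin k → Fin k → Bool) × Bool)
    (fun v => (v.sym, v.cell, v.cur, v.acc, v.found)) fun v w h => by
      cases v; cases w; simp_all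

noncomputable instance : Fintype (Mem k) := Fintype.ofFinite _

def Mem.clear (v : Mem k) : Mem k := { v with sym := none, cell := none }

def Mem.mark (v : Mem k) : Marks k := v.cell.getD fun _ => false

/-- Start to advance the entry `i` of the tuple; there is nothing left to do if `i = k`. -/
def incLab (k i : ℕ) : Lab k := if h : i < k then .inc ⟨i, h⟩ else .fin

open TM2.Stmt

abbrev Prog (k : ℕ) := TM2.Stmt (Alph k) (Lab k) (Mem k)

/-- Forgetting the symbols read last keeps the memory in a normal form whenever a label is entered,
so that the lemmas on single phases can be chained. -/
def goClear (l : Lab k) : Prog k := load Mem.clear <| goto fun _ => l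

/-- Pop `col` (or `col'`) into the memory, and `row` (or `row'`) in parallel. -/
def popBoth (q : Prog k) : Prog k :=
  pop .col (fun v a => { v with cell := a }) <| pop .row (fun v _ => v) q

def popBoth' (q : Prog k) : Prog k :=
  pop .col' (fun v a => { v with cell := a }) <| pop .row' (fun v _ => v) q

def pushBoth (f : Mem k → Marks k) (q : Prog k) : Prog k := push .col f <| push .row f q

def pushBoth' (f : Mem k → Marks k) (q : Prog k) : Prog k := push .col' f <| push .row' f q

/-- The program that decides whether no `k`-tuple of vertices has an adjacency matrix that
satisfies `P`. -/
def prog (P : (Fin k → Fin k → Bool) → Bool) : Lab k → Prog k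
  | .setup =>
    pop .inp (fun v a => { v with sym := a }) <|
    branch (fun v => v.sym.isSome)
      (push .done (fun v => v.sym.getD none) <|
       -- The outer `none` means that the tape is empty, the inner one that a row ends.
       branch (fun v => (v.sym.getD none).isSome)
        (pushBoth (fun _ _ => false) <| goClear .setup)
        -- After the first matrix row the words have one letter per vertex; giving all marks to the
        -- top letter makes every entry of the tuple equal to vertex `0`.
        (popBoth <| pushBoth (fun _ _ => true) <| goClear .back))
      (goClear .fin)
  | .back =>
    pop .done (fun v a => { v with sym := a }) <|
    branch (fun v => v.sym.isSome)
      (push .inp (fun v => v.sym.getD none) <| goClear .back)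
      (goClear .row)
  | .row =>
    pop .row (fun v a => { v with cell := a }) <|
    branch (fun v => v.cell.isSome)
      (push .row' Mem.mark <| load (fun v => { v with cur := v.mark }) <| goClear .col)
      (goClear .unRow)
  | .col =>
    pop .inp (fun v a => { v with sym := a }) <|
    push .done (fun v => v.sym.getD none) <|
    branch (fun v => (v.sym.getD none).isSome)
      (pop .col (fun v a => { v with cell := a }) <|
       push .col' Mem.mark <|
       load (fun v => { v with
        acc := fun s t => v.acc s t || (v.cur s && v.mark t && (v.sym.getD none).getD false) }) <|
       goClear .col)
      (goClear .unCol)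
  | .unCol =>
    pop .col' (fun v a => { v with cell := a }) <|
    branch (fun v => v.cell.isSome)
      (push .col Mem.mark <| goClear .unCol)
      (load (fun v => { v with cur := fun _ => false }) <| goClear .row)
  | .unRow =>
    pop .row' (fun v a => { v with cell := a }) <|
    branch (fun v => v.cell.isSome)
      (push .row Mem.mark <| goClear .unRow)
      (load (fun v => { v with found := v.found || P v.acc, acc := fun _ _ => false }) <|
       goClear (incLab k 0))
  | .inc t =>
    popBoth <|
    branch (fun v => v.mark t)
      (pushBoth' (fun v => Function.update v.mark t false) <| goClear (.place t))
      (pushBoth' Mem.mark <| goClear (.inc t))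
  | .place t =>
    popBoth <|
    branch (fun v => v.cell.isSome)
      (pushBoth (fun v => Function.update v.mark t true) <| goClear .rest)
      (goClear (.wrap t))
  | .rest =>
    popBoth' <|
    branch (fun v => v.cell.isSome)
      (pushBoth Mem.mark <| goClear .rest)
      (goClear .back)
  | .wrap t =>
    popBoth' <|
    branch (fun v => v.cell.isSome)
      (pushBoth Mem.mark <| goClear (.wrap t))
      (popBoth <| pushBoth (fun v => Function.update v.mark t true) <|
        goClear (incLab k (t + 1)))
  | .fin =>
    pop .done (fun v a => { v with sym := a }) <|
    popBoth <|
    branch (fun v => v.sym.isSome)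
      (goClear .fin)
      (push .out (fun v => !v.found) <| load (fun _ => {}) halt)

/-- The machine that runs `prog P`. -/
noncomputable def machine (P : (Fin k → Fin k → Bool) → Bool) : FinTM2 where
  K := Stk
  k₀ := .inp
  k₁ := .out
  Γ := Alph k
  Λ := Lab k
  main := .setup
  σ := Mem k
  initialState := {}
  Γk₀Fin := inferInstanceAs (Fintype (Option Bool))
  m := prog P

/-- Stack contents given one by one. -/
def tapes (i d : List (Option Bool)) (r r' c c' : List (Marks k)) (o : List Bool) :
    ∀ s, List (Alph k s)
  | .inp => i
  | .done => d
  | .row => r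
  | .row' => r'
  | .col => c
  | .col' => c'
  | .out => o

section Update

variable (i d j : List (Option Bool)) (r r' c c' w : List (Marks k)) (o o' : List Bool)

@[simp] lemma tapes_update_inp : Function.update (tapes i d r r' c c' o) .inp j =
    tapes j d r r' c c' o := by funext s; cases s <;> simp [tapes]
@[simp] lemma tapes_update_done : Function.update (tapes i d r r' c c' o) .done j =
    tapes i j r r' c c' o := by funext s; cases s <;> simp [tapes]
@[simp] lemma tapes_update_row : Function.update (tapes i d r r' c c' o) .row w =
    tapes i d w r' c c' o := by funext s; cases s <;> simp [tapes]
@[simp] lemma tapes_update_row' : Function.update (tapes i d r r' c c' o) .row' w =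
    tapes i d r w c c' o := by funext s; cases s <;> simp [tapes]
@[simp] lemma tapes_update_col : Function.update (tapes i d r r' c c' o) .col w =
    tapes i d r r' w c' o := by funext s; cases s <;> simp [tapes]
@[simp] lemma tapes_update_col' : Function.update (tapes i d r r' c c' o) .col' w =
    tapes i d r r' c w o := by funext s; cases s <;> simp [tapes]
@[simp] lemma tapes_update_out : Function.update (tapes i d r r' c c' o) .out o' =
    tapes i d r r' c c' o' := by funext s; cases s <;> simp [tapes]

@[simp] lemma tapes_inp : tapes i d r r' c c' o .inp = i := rfl
@[simp] lemma tapes_done : tapes i d r r' c c' o .done = d := rfl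
@[simp] lemma tapes_row : tapes i d r r' c c' o .row = r := rfl
@[simp] lemma tapes_row' : tapes i d r r' c c' o .row' = r' := rfl
@[simp] lemma tapes_col : tapes i d r r' c c' o .col = c := rfl
@[simp] lemma tapes_col' : tapes i d r r' c c' o .col' = c' := rfl
@[simp] lemma tapes_out : tapes i d r r' c c' o .out = o := rfl

end Update

/-! ### Runs of the single phases -/

abbrev Conf (k : ℕ) := TM2.Cfg (Alph k) (Lab k) (Mem k)

/-- `P`'s machine gets from `a` to `b` in at most `t` steps. -/
def Runs (P : (Fin k → Fin k → Bool) → Bool) (a b : Conf k) (t : ℕ) : Prop :=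
  ∃ s ≤ t, (flip bind (TM2.step (prog P)))^[s] (some a) = some b

variable {P : (Fin k → Fin k → Bool) → Bool} {a b c : Conf k}

lemma Runs.refl (a : Conf k) : Runs P a a 0 := ⟨0, le_rfl, rfl⟩

lemma Runs.mono {t t' : ℕ} (h : Runs P a b t) (ht : t ≤ t') : Runs P a b t' :=
  let ⟨s, hs, e⟩ := h; ⟨s, hs.trans ht, e⟩

lemma Runs.congr {b' : Conf k} {t t' : ℕ} (h : Runs P a b t) (hb : b = b') (ht : t ≤ t') :
    Runs P a b' t' :=
  hb ▸ h.mono ht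

lemma Runs.trans {t t' : ℕ} (h : Runs P a b t) (h' : Runs P b c t') : Runs P a c (t + t') := by
  obtain ⟨s, hs, e⟩ := h
  obtain ⟨s', hs', e'⟩ := h'
  exact ⟨s' + s, by omega, by rw [Function.iterate_add_apply, e, e']⟩

lemma Runs.step (h : TM2.step (prog P) a = some b) : Runs P a b 1 :=
  ⟨1, le_rfl, h⟩

lemma Runs.head {t : ℕ} (h : TM2.step (prog P) a = some b) (h' : Runs P b c t) :
    Runs P a c (t + 1) := by
  rw [add_comm]; exact (Runs.step h).trans h'

variable {i d : List (Option Bool)} {r r' cs cs' : List (Marks k)} {o : List Bool}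

lemma runs_back (v : Mem k) (hv : v.clear = v) :
    Runs P ⟨some .back, v, tapes i d r r' cs cs' o⟩
      ⟨some .row, v, tapes (d.reverse ++ i) [] r r' cs cs' o⟩ (d.length + 1) := by
  induction d generalizing i with
  | nil =>
    apply Runs.step
    rw [← hv]; simp [prog, goClear, Mem.clear]
  | cons x d ih =>
    refine Runs.head ?_ (by simpa using ih (i := x :: i))
    rw [← hv]; simp [prog, goClear, Mem.clear]

/-- No marks. -/
abbrev noMarks (k : ℕ) : Marks k := fun _ => false

lemma runs_unRow (w : Marks k) (acc : Fin k → Fin k → Bool) (f : Bool) :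
    Runs P ⟨some .unRow, ⟨none, none, w, acc, f⟩, tapes i d r r' cs cs' o⟩
      ⟨some (incLab k 0), ⟨none, none, w, fun _ _ => false, f || P acc⟩,
        tapes i d (r'.reverse ++ r) [] cs cs' o⟩ (r'.length + 1) := by
  induction r' generalizing r with
  | nil =>
    apply Runs.step
    simp [prog, goClear, Mem.clear]
  | cons x r' ih =>
    refine Runs.head ?_ (by simpa using ih (r := x :: r))
    simp [prog, goClear, Mem.clear, Mem.mark]

lemma runs_unCol (w : Marks k) (acc : Fin k → Fin k → Bool) (f : Bool) :
    Runs P ⟨some .unCol, ⟨none, none, w, acc, f⟩, tapes i d r r' cs cs' o⟩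
      ⟨some .row, ⟨none, none, noMarks k, acc, f⟩,
        tapes i d r r' (cs'.reverse ++ cs) [] o⟩ (cs'.length + 1) := by
  induction cs' generalizing cs with
  | nil =>
    apply Runs.step
    simp [prog, goClear, Mem.clear]
  | cons x r' ih =>
    refine Runs.head ?_ (by simpa using ih (cs := x :: cs))
    simp [prog, goClear, Mem.clear, Mem.mark]

/-- The encoding of one row of an adjacency matrix. -/
def rowCode {ι : Type*} (js : List ι) (b : ι → Bool) : List (Option Bool) :=
  js.map (fun j => some (b j)) ++ [none]

/-- The encoding of an adjacency matrix. -/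
def matCode {ι : Type*} (is js : List ι) (b : ι → ι → Bool) : List (Option Bool) :=
  is.flatMap fun i => rowCode js (b i)

lemma length_matCode {ι : Type*} (is js : List ι) (b : ι → ι → Bool) :
    (matCode is js b).length = is.length * (js.length + 1) := by
  simp [matCode, rowCode, List.length_flatMap]

/-- The matrix row and the word `col` are read in lockstep, so the marks popped belong to the column
of the entry just read; `w` holds the marks of the row. -/
lemma runs_col {ι : Type*} (js : List ι) (b : ι → Bool) (m : ι → Marks k)
    (w : Marks k) (acc : Fin k → Fin k → Bool) (f : Bool) :
    Runs P ⟨some .col, ⟨none, none, w, acc, f⟩,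
        tapes (rowCode js b ++ i) d r r' (js.map m ++ cs) cs' o⟩
      ⟨some .unCol, ⟨none, none, w,
          fun s t => acc s t || (w s && js.any fun j => m j t && b j), f⟩,
        tapes i ((rowCode js b).reverse ++ d) r r' cs ((js.map m).reverse ++ cs') o⟩
      (js.length + 1) := by
  induction js generalizing acc d cs' with
  | nil =>
    apply Runs.step
    simp [prog, goClear, Mem.clear, rowCode]
  | cons x js ih =>
    refine Runs.head (b := ⟨some .col, ⟨none, none, w,
          fun s t => acc s t || (w s && m x t && b x), f⟩,
        tapes (rowCode js b ++ i) (some (b x) :: d) r r' (js.map m ++ cs) (m x :: cs') o⟩) ?_ ?_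
    · simp [prog, goClear, Mem.clear, Mem.mark, rowCode]
    · refine (ih _).congr ?_ (by simp)
      simp [rowCode, Bool.or_assoc, Bool.and_or_distrib_left, Bool.and_assoc]

lemma runs_rows {ι : Type*} (is js : List ι) (b : ι → ι → Bool) (m : ι → Marks k)
    (acc : Fin k → Fin k → Bool) (f : Bool) :
    Runs P ⟨some .row, ⟨none, none, noMarks k, acc, f⟩,
        tapes (matCode is js b) d (is.map m) r' (js.map m) [] o⟩
      ⟨some .unRow, ⟨none, none, noMarks k,
          fun s t => acc s t || is.any fun i => m i s && js.any fun j => m j t && b i j, f⟩,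
        tapes [] ((matCode is js b).reverse ++ d) [] ((is.map m).reverse ++ r') (js.map m) [] o⟩
      (is.length * (2 * js.length + 3) + 1) := by
  induction is generalizing acc d r' with
  | nil =>
    refine Runs.mono (Runs.step ?_) (by omega)
    simp [prog, goClear, Mem.clear, matCode]
  | cons x is ih =>
    have h1 : Runs P ⟨some .row, ⟨none, none, noMarks k, acc, f⟩,
        tapes (matCode (x :: is) js b) d ((x :: is).map m) r' (js.map m) [] o⟩
        ⟨some .col, ⟨none, none, m x, acc, f⟩,
        tapes (rowCode js (b x) ++ matCode is js b) d (is.map m) (m x :: r') (js.map m ++ []) [] o⟩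
        1 := by
      apply Runs.step
      simp [prog, goClear, Mem.clear, Mem.mark, matCode]
    have h2 := (h1.trans (runs_col ..)).trans (runs_unCol ..)
    simp only [List.append_nil, List.reverse_reverse] at h2
    refine (h2.trans (ih _)).congr ?_ ?_
    · simp [matCode, Bool.or_assoc]
    · simp only [List.length_cons, List.length_reverse, List.length_map]; nlinarith

/-- One evaluation of `P`, at the tuple described by the marks `m`. -/
lemma runs_check {ι : Type*} (js : List ι) (b : ι → ι → Bool) (m : ι → Marks k) (f : Bool) :
    Runs P ⟨some .row, ⟨none, none, noMarks k, fun _ _ => false, f⟩,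
        tapes (matCode js js b) [] (js.map m) [] (js.map m) [] o⟩
      ⟨some (incLab k 0), ⟨none, none, noMarks k, fun _ _ => false,
          f || P fun s t => js.any fun i => m i s && js.any fun j => m j t && b i j⟩,
        tapes [] (matCode js js b).reverse (js.map m) [] (js.map m) [] o⟩
      (js.length * (2 * js.length + 4) + 2) := by
  refine ((runs_rows ..).trans (runs_unRow ..)).congr (by simp) ?_
  simp only [List.append_nil, List.length_reverse, List.length_map]
  nlinarith

/-- The first letter with mark `t` is the current value of entry `t`. The scan stops just past it,
with the mark erased, so that the next letter can receive it. -/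
lemma runs_inc (t : Fin k) (acc : Fin k → Fin k → Bool) (f : Bool) (w : Marks k)
    (l₁ l₂ l' : List (Marks k)) (h₁ : ∀ u ∈ l₁, u t = false) (hw : w t = true) :
    Runs P ⟨some (.inc t), ⟨none, none, noMarks k, acc, f⟩,
        tapes i d (l₁ ++ w :: l₂) l' (l₁ ++ w :: l₂) l' o⟩
      ⟨some (.place t), ⟨none, none, noMarks k, acc, f⟩,
        tapes i d l₂ (Function.update w t false :: (l₁.reverse ++ l'))
          l₂ (Function.update w t false :: (l₁.reverse ++ l')) o⟩ (l₁.length + 1) := by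
  induction l₁ generalizing l' with
  | nil =>
    apply Runs.step
    simp [prog, popBoth, pushBoth', goClear, Mem.clear, Mem.mark, hw]
  | cons x l₁ ih =>
    refine Runs.head ?_ (by simpa using ih (x :: l') (fun u hu => h₁ u (by simp [hu])))
    simp [prog, popBoth, pushBoth', goClear, Mem.clear, Mem.mark, h₁ x]

lemma runs_rest (acc : Fin k → Fin k → Bool) (f : Bool) (l l' : List (Marks k)) :
    Runs P ⟨some .rest, ⟨none, none, noMarks k, acc, f⟩, tapes i d l l' l l' o⟩
      ⟨some .back, ⟨none, none, noMarks k, acc, f⟩,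
        tapes i d (l'.reverse ++ l) [] (l'.reverse ++ l) [] o⟩ (l'.length + 1) := by
  induction l' generalizing l with
  | nil =>
    apply Runs.step
    simp [prog, popBoth', goClear, Mem.clear]
  | cons x l' ih =>
    refine Runs.head ?_ (by simpa using ih (x :: l))
    simp [prog, popBoth', pushBoth, goClear, Mem.clear, Mem.mark]

/-- The hypothesis `h` describes the fully rewound word, whose first letter `u` then receives mark
`t`. -/
lemma runs_wrap (t : Fin k) (acc : Fin k → Fin k → Bool) (f : Bool) (u : Marks k)
    (l l₂ l' : List (Marks k)) (h : l'.reverse ++ l = u :: l₂) :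
    Runs P ⟨some (.wrap t), ⟨none, none, noMarks k, acc, f⟩, tapes i d l l' l l' o⟩
      ⟨some (incLab k (t + 1)), ⟨none, none, noMarks k, acc, f⟩,
        tapes i d (Function.update u t true :: l₂) [] (Function.update u t true :: l₂) [] o⟩
      (l'.length + 1) := by
  induction l' generalizing l with
  | nil =>
    apply Runs.step
    obtain rfl : l = u :: l₂ := by simpa using h
    simp [prog, popBoth', popBoth, pushBoth, goClear, Mem.clear, Mem.mark]
  | cons x l' ih =>
    refine Runs.head ?_ (by simpa using ih (x :: l) (by simpa using h))
    simp [prog, popBoth', pushBoth, goClear, Mem.clear, Mem.mark]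

/-- The entry `t` of the tuple is increased. -/
lemma runs_advance (t : Fin k) (acc : Fin k → Fin k → Bool) (f : Bool) (w u : Marks k)
    (l₁ l₂ : List (Marks k)) (h₁ : ∀ u ∈ l₁, u t = false) (hw : w t = true) :
    Runs P ⟨some (.inc t), ⟨none, none, noMarks k, acc, f⟩,
        tapes [] d (l₁ ++ w :: u :: l₂) [] (l₁ ++ w :: u :: l₂) [] o⟩
      ⟨some .row, ⟨none, none, noMarks k, acc, f⟩,
        tapes d.reverse []
          (l₁ ++ Function.update w t false :: Function.update u t true :: l₂) []
          (l₁ ++ Function.update w t false :: Function.update u t true :: l₂) [] o⟩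
      (2 * l₁.length + d.length + 5) := by
  have h1 := runs_inc (P := P) (i := []) (d := d) (o := o) t acc f w l₁ (u :: l₂) [] h₁ hw
  refine Runs.mono (h1.trans (Runs.head (t := l₁.length + 2 + (d.length + 1)) (b :=
    ⟨some .rest, ⟨none, none, noMarks k, acc, f⟩, tapes [] d (Function.update u t true :: l₂)
      (Function.update w t false :: (l₁.reverse ++ [])) (Function.update u t true :: l₂)
      (Function.update w t false :: (l₁.reverse ++ [])) o⟩) ?_ ?_)) (by omega)
  · simp [prog, popBoth, pushBoth, goClear, Mem.clear, Mem.mark]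
  · have h2 := (runs_rest (P := P) (i := []) (d := d) (o := o) acc f
      (Function.update u t true :: l₂) (Function.update w t false :: (l₁.reverse ++ []))).trans
      (runs_back _ rfl)
    simpa using h2

/-- The entry `t` of the tuple is maximal and returns to zero. -/
lemma runs_carry (t : Fin k) (acc : Fin k → Fin k → Bool) (f : Bool) (w u : Marks k)
    (l₁ l₂ : List (Marks k)) (h₁ : ∀ u ∈ l₁, u t = false) (hw : w t = true)
    (h : l₁ ++ [Function.update w t false] = u :: l₂) :
    Runs P ⟨some (.inc t), ⟨none, none, noMarks k, acc, f⟩,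
        tapes i d (l₁ ++ [w]) [] (l₁ ++ [w]) [] o⟩
      ⟨some (incLab k (t + 1)), ⟨none, none, noMarks k, acc, f⟩,
        tapes i d (Function.update u t true :: l₂) [] (Function.update u t true :: l₂) [] o⟩
      (2 * l₁.length + 5) := by
  have h1 := runs_inc (P := P) (i := i) (d := d) (o := o) t acc f w l₁ [] [] h₁ hw
  refine Runs.mono (h1.trans (Runs.head (b :=
    ⟨some (.wrap t), ⟨none, none, noMarks k, acc, f⟩, tapes i d []
      (Function.update w t false :: (l₁.reverse ++ [])) []
      (Function.update w t false :: (l₁.reverse ++ [])) o⟩) ?_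
      (runs_wrap t acc f u _ l₂ _ (by simpa using h)))) (by simp; omega)
  simp [prog, popBoth, goClear, Mem.clear]

/-- A halting configuration must have every tape but the output empty. Since the tuple words are no
longer than the matrix, emptying all in parallel until `done` runs out clears them too. -/
lemma runs_fin (f : Bool) (l : List (Marks k)) (acc : Fin k → Fin k → Bool)
    (hl : l.length ≤ d.length) :
    Runs P ⟨some .fin, ⟨none, none, noMarks k, acc, f⟩, tapes [] d l [] l [] []⟩
      ⟨none, {}, tapes [] [] [] [] [] [] [!f]⟩ (d.length + 1) := by
  induction d generalizing l with
  | nil =>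
    obtain rfl : l = [] := by simpa using hl
    apply Runs.step
    simp [prog, popBoth]
  | cons x d ih =>
    refine Runs.head ?_ (ih l.tail (by simp at hl ⊢; omega))
    simp [prog, popBoth, goClear, Mem.clear]

lemma runs_setup_aux (f : Bool) (acc : Fin k → Fin k → Bool) (a : List Bool) (l : List (Marks k)) :
    Runs P ⟨some .setup, ⟨none, none, noMarks k, acc, f⟩,
        tapes (a.map some ++ i) d l [] l [] []⟩
      ⟨some .setup, ⟨none, none, noMarks k, acc, f⟩, tapes i ((a.map some).reverse ++ d)
        (List.replicate a.length (noMarks k) ++ l) []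
        (List.replicate a.length (noMarks k) ++ l) [] []⟩ a.length := by
  induction a generalizing d l with
  | nil => exact Runs.refl _
  | cons x a ih =>
    refine Runs.head (b := ⟨some .setup, ⟨none, none, noMarks k, acc, f⟩,
        tapes (a.map some ++ i) (some x :: d) (noMarks k :: l) [] (noMarks k :: l) [] []⟩) ?_ ?_
    · simp [prog, pushBoth, goClear, Mem.clear]
    · convert ih _ using 2
      have : ∀ n, List.replicate n (noMarks k) ++ noMarks k :: l
          = List.replicate (n + 1) (noMarks k) ++ l := fun n => by
        rw [List.replicate_succ', List.append_assoc]; rfl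
      simp only [List.length_cons, List.map_cons, List.reverse_cons, List.append_assoc,
        List.singleton_append, this]

lemma runs_setup (f : Bool) (acc : Fin k → Fin k → Bool) (x : Bool) (a : List Bool) :
    Runs P ⟨some .setup, ⟨none, none, noMarks k, acc, f⟩,
        tapes ((x :: a).map some ++ none :: i) [] [] [] [] [] []⟩
      ⟨some .row, ⟨none, none, noMarks k, acc, f⟩, tapes ((x :: a).map some ++ none :: i) []
        ((fun _ => true) :: List.replicate a.length (noMarks k)) []
        ((fun _ => true) :: List.replicate a.length (noMarks k)) [] []⟩ (2 * a.length + 5) := by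
  refine Runs.mono ((runs_setup_aux (i := none :: i) (d := []) f acc (x :: a) []).trans
    (Runs.head (b := ⟨some .back, ⟨none, none, noMarks k, acc, f⟩,
      tapes i (none :: (((x :: a).map some).reverse ++ []))
        ((fun _ => true) :: List.replicate a.length (noMarks k)) []
        ((fun _ => true) :: List.replicate a.length (noMarks k)) [] []⟩) (t := a.length + 3) ?_ ?_))
    (by simp; omega)
  · simp [prog, popBoth, pushBoth, goClear, Mem.clear, List.replicate_succ]
  · have := runs_back (P := P) (i := i) (d := none :: (((x :: a).map some).reverse ++ []))
      (r := (fun _ => true) :: List.replicate a.length (noMarks k)) (r' := [])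
      (cs := (fun _ => true) :: List.replicate a.length (noMarks k)) (cs' := []) (o := [])
      ⟨none, none, noMarks k, acc, f⟩ rfl
    simpa using this

/-! ### Tuples as words, and the odometer -/

/-- The word of length `n` that represents the tuple `x`. -/
def tupleWord (n : ℕ) (x : Fin k → ℕ) : List (Marks k) :=
  (List.range n).map fun j t => decide (x t = j)

lemma length_tupleWord (n : ℕ) (x : Fin k → ℕ) : (tupleWord n x).length = n := by
  simp [tupleWord]

lemma runs_advance_tuple (n : ℕ) (x : Fin k → ℕ) (t : Fin k) (ht : x t + 1 < n)
    (acc : Fin k → Fin k → Bool) (f : Bool) :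
    Runs P ⟨some (.inc t), ⟨none, none, noMarks k, acc, f⟩,
        tapes [] d (tupleWord n x) [] (tupleWord n x) [] o⟩
      ⟨some .row, ⟨none, none, noMarks k, acc, f⟩,
        tapes d.reverse [] (tupleWord n (Function.update x t (x t + 1))) []
          (tupleWord n (Function.update x t (x t + 1))) [] o⟩ (2 * n + d.length + 5) := by
  -- Only the letters `x t` and `x t + 1` change, so the word is split around these two.
  obtain ⟨m, rfl⟩ := Nat.exists_eq_add_of_le (show x t + 2 ≤ n by omega)
  have hr : List.range (x t + 2 + m) = List.range (x t) ++ x t :: (x t + 1) ::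
      (List.range m).map (x t + 2 + ·) := by
    rw [List.range_add, List.range_succ, List.range_succ]; simp
  have h := runs_advance (P := P) (d := d) (o := o) t acc f (fun s => decide (x s = x t))
    (fun s => decide (x s = x t + 1))
    ((List.range (x t)).map fun j s => decide (x s = j))
    (((List.range m).map (x t + 2 + ·)).map fun j s => decide (x s = j))
    (by
      intro u hu
      obtain ⟨j, hj, rfl⟩ := List.mem_map.1 hu
      rw [List.mem_range] at hj
      simp; omega)
    (by simp)
  have h1 : ∀ y : Fin k → ℕ, tupleWord (x t + 2 + m) y =
      (List.range (x t)).map (fun j s => decide (y s = j)) ++ (fun s => decide (y s = x t)) ::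
        (fun s => decide (y s = x t + 1)) ::
        ((List.range m).map (x t + 2 + ·)).map fun j s => decide (y s = j) := by
    intro y; rw [tupleWord, hr]; simp
  rw [h1 x]
  refine h.congr ?_ (by simp; omega)
  congr 1
  have h2 : (List.range (x t)).map (fun j s => decide (x s = j)) ++
      Function.update (fun s => decide (x s = x t)) t false ::
      Function.update (fun s => decide (x s = x t + 1)) t true ::
      ((List.range m).map (x t + 2 + ·)).map (fun j s => decide (x s = j)) =
      tupleWord (x t + 2 + m) (Function.update x t (x t + 1)) := by
    rw [h1]
    congr 1
    · refine List.map_congr_left fun j hj => funext fun s => ?_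
      rw [List.mem_range] at hj
      by_cases hs : s = t
      · subst hs; simp; omega
      · simp [hs]
    · congr 1
      · funext s
        by_cases hs : s = t
        · subst hs; simp
        · simp [hs]
      · congr 1
        · funext s
          by_cases hs : s = t
          · subst hs; simp
          · simp [hs]
        · refine List.map_congr_left fun j hj => funext fun s => ?_
          obtain ⟨j, -, rfl⟩ := List.mem_map.1 hj
          by_cases hs : s = t
          · subst hs; simp; omega
          · simp [hs]
  rw [h2]

lemma runs_carry_tuple (n : ℕ) (x : Fin k → ℕ) (t : Fin k) (ht : x t + 1 = n)
    {i : List (Option Bool)} (acc : Fin k → Fin k → Bool) (f : Bool) :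
    Runs P ⟨some (.inc t), ⟨none, none, noMarks k, acc, f⟩,
        tapes i d (tupleWord n x) [] (tupleWord n x) [] o⟩
      ⟨some (incLab k (t + 1)), ⟨none, none, noMarks k, acc, f⟩,
        tapes i d (tupleWord n (Function.update x t 0)) []
          (tupleWord n (Function.update x t 0)) [] o⟩ (2 * n + 5) := by
  subst ht
  -- The letters with mark `t` erased. This form also covers `n = 1`, where the first letter is the
  -- one that loses the mark.
  set m : ℕ → Marks k := fun j => Function.update (fun s => decide (x s = j)) t false with hm
  have h1 : tupleWord (x t + 1) x = (List.range (x t)).map (fun j s => decide (x s = j)) ++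
      [fun s => decide (x s = x t)] := by
    rw [tupleWord, List.range_succ]; simp
  have h := runs_carry (P := P) (i := i) (d := d) (o := o) t acc f (fun s => decide (x s = x t))
    (m 0) ((List.range (x t)).map fun j s => decide (x s = j))
    (((List.range (x t)).map Nat.succ).map m)
    (by
      intro u hu
      obtain ⟨j, hj, rfl⟩ := List.mem_map.1 hu
      rw [List.mem_range] at hj
      simp; omega)
    (by simp)
    (by
      rw [← List.map_cons, ← List.range_succ_eq_map, List.range_succ, List.map_append]
      congr 1
      refine List.map_congr_left fun j hj => funext fun s => ?_
      rw [List.mem_range] at hj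
      by_cases hs : s = t
      · subst hs; simp [hm, hj.ne']
      · simp [hm, hs])
  rw [h1]
  refine h.congr ?_ (by simp)
  congr 1
  have h2 : Function.update (m 0) t true :: ((List.range (x t)).map Nat.succ).map m =
      tupleWord (x t + 1) (Function.update x t 0) := by
    rw [tupleWord, List.range_succ_eq_map, List.map_cons]
    congr 1
    · funext s
      by_cases hs : s = t
      · subst hs; simp
      · simp [hm, hs]
    · refine List.map_congr_left fun j hj => funext fun s => ?_
      obtain ⟨j, -, rfl⟩ := List.mem_map.1 hj
      by_cases hs : s = t
      · subst hs; simp [hm]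
      · simp [hm, hs]
  rw [h2]

/-- The machine is about to evaluate `P` at the tuple `x`. -/
def ready (n : ℕ) (b : ℕ → ℕ → Bool) (x : Fin k → ℕ) (f : Bool) : Conf k :=
  ⟨some .row, ⟨none, none, noMarks k, fun _ _ => false, f⟩,
    tapes (matCode (List.range n) (List.range n) b) [] (tupleWord n x) [] (tupleWord n x) [] []⟩

/-- The machine is about to advance the entry `i` of the tuple `x`. -/
def checked (n : ℕ) (b : ℕ → ℕ → Bool) (i : ℕ) (x : Fin k → ℕ) (f : Bool) : Conf k :=
  ⟨some (incLab k i), ⟨none, none, noMarks k, fun _ _ => false, f⟩,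
    tapes [] (matCode (List.range n) (List.range n) b).reverse
      (tupleWord n x) [] (tupleWord n x) [] []⟩

/-- A bound for the time in which the first `d` entries of a tuple run through all values. -/
def loopTime (L : ℕ) : ℕ → ℕ
  | 0 => L * (2 * L + 4) + 2
  | d + 1 => L * (loopTime L d + (3 * L + 5))

variable {n L : ℕ} {b : ℕ → ℕ → Bool}

lemma runs_ready (x : Fin k → ℕ) (f : Bool) (hx : ∀ t, x t < n) :
    Runs P (ready n b x f) (checked n b 0 x (f || P fun s t => b (x s) (x t)))
      (n * (2 * n + 4) + 2) := by
  refine (runs_check (o := []) (List.range n) b (fun j t => decide (x t = j)) f).congr ?_ (by simp)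
  -- Each index marks exactly one letter, so the double disjunction picks out a single matrix entry.
  have : (fun s t => (List.range n).any fun i => decide (x s = i) &&
      (List.range n).any fun j => decide (x t = j) && b i j) = fun s t => b (x s) (x t) := by
    funext s t
    rw [Bool.eq_iff_iff]
    simp [hx]
  rw [this]
  rfl

/-- Nested loops, by induction on their number `e`: the first `e` entries start at zero, take all
values and return to zero, while the later entries stay fixed. -/
lemma runs_loop (hL : n * (n + 1) ≤ L) (e : ℕ) (he : e ≤ k) (x : Fin k → ℕ) (f : Bool)
    (hx : ∀ t, x t < n) (h0 : ∀ t : Fin k, t < e → x t = 0) :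
    ∃ f', Runs P (ready n b x f) (checked n b e x f') (loopTime L e) ∧
      (f' = true ↔ f = true ∨ ∃ y : Fin k → ℕ, (∀ t, y t < n) ∧ (∀ t : Fin k, e ≤ t → y t = x t) ∧
        P (fun s t => b (y s) (y t)) = true) := by
  have hnL : n ≤ L := by nlinarith
  induction e generalizing x f with
  | zero =>
    refine ⟨_, (runs_ready x f hx).mono ?_, ?_⟩
    · simp only [loopTime]; gcongr
    · rw [Bool.or_eq_true]
      refine or_congr Iff.rfl ⟨fun h => ⟨x, hx, fun _ _ => rfl, h⟩, ?_⟩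
      rintro ⟨y, -, hy, h⟩
      obtain rfl : y = x := funext fun t => hy t (Nat.zero_le _)
      exact h
  | succ e ih =>
    set t₀ : Fin k := ⟨e, he⟩ with ht₀
    have hlab : incLab k e = .inc t₀ := by simp [incLab, ht₀, Nat.lt_of_succ_le he]
    -- Here `r` counts the increments of entry `e` still to come; only tuples with `x t₀ ≤ y t₀`
    -- remain to be tested.
    have key : ∀ (r : ℕ) (x : Fin k → ℕ) (f : Bool), (∀ t, x t < n) →
        (∀ t : Fin k, t < e → x t = 0) → x t₀ + r + 1 = n →
        ∃ f', Runs P (ready n b x f) (checked n b (e + 1) (Function.update x t₀ 0) f')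
            ((r + 1) * (loopTime L e + (3 * L + 5))) ∧
          (f' = true ↔ f = true ∨ ∃ y : Fin k → ℕ, (∀ t, y t < n) ∧
            (∀ t : Fin k, e + 1 ≤ t → y t = x t) ∧ x t₀ ≤ y t₀ ∧
            P (fun s t => b (y s) (y t)) = true) := by
      intro r
      induction r with
      | zero =>
        intro x f hx h0 hr
        obtain ⟨f', h1, h2⟩ := ih (by omega) x f hx h0
        refine ⟨f', (h1.trans (b := checked n b e x f') (t' := 2 * n + 5) ?_).mono
          (by omega), h2.trans (or_congr Iff.rfl ?_)⟩
        · have := runs_carry_tuple (P := P) (o := []) (i := [])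
            (d := (matCode (List.range n) (List.range n) b).reverse) n x t₀ (by omega)
            (fun _ _ => false) f'
          simpa [checked, hlab] using this
        · refine exists_congr fun y => and_congr_right fun hy => ?_
          rw [← and_assoc (a := ∀ t : Fin k, e + 1 ≤ t → y t = x t)]
          refine and_congr ⟨fun h => ⟨fun t ht => h t (by omega), (h t₀ le_rfl).ge⟩, ?_⟩ Iff.rfl
          rintro ⟨h, h'⟩ t ht
          rcases Nat.eq_or_lt_of_le ht with h'' | h''
          · obtain rfl : t = t₀ := Fin.ext h''.symm
            have := hy t₀; omega
          · exact h t h''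
      | succ r ihr =>
        intro x f hx h0 hr
        obtain ⟨f', h1, h2⟩ := ih (by omega) x f hx h0
        have hx' : ∀ t, Function.update x t₀ (x t₀ + 1) t < n := by
          intro t
          by_cases ht : t = t₀
          · subst ht; simp; omega
          · simp [ht, hx]
        obtain ⟨f'', h3, h4⟩ := ihr (Function.update x t₀ (x t₀ + 1)) f' hx'
          (fun t ht => by
            have : t ≠ t₀ := by rintro rfl; simp [ht₀] at ht
            simpa [this] using h0 t ht)
          (by simp; omega)
        refine ⟨f'', ?_, ?_⟩
        · have h5 := runs_advance_tuple (P := P) (o := [])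
            (d := (matCode (List.range n) (List.range n) b).reverse) n x t₀ (by omega)
            (fun _ _ => false) f'
          simp only [List.reverse_reverse, List.length_reverse, length_matCode,
            List.length_range] at h5
          have h6 : Runs P (checked n b e x f') (ready n b (Function.update x t₀ (x t₀ + 1)) f')
              (3 * L + 5) := by
            refine Runs.mono ?_ (show 2 * n + n * (n + 1) + 5 ≤ _ by omega)
            simpa [checked, ready, hlab] using h5
          simp only [Function.update_idem] at h3
          exact ((h1.trans h6).trans h3).mono (le_of_eq (by ring))
        · rw [h4, h2, or_assoc]
          refine or_congr Iff.rfl ⟨?_, ?_⟩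
          · rintro (⟨y, hy, h, hp⟩ | ⟨y, hy, h, h', hp⟩)
            · exact ⟨y, hy, fun t ht => h t (by omega), (h t₀ le_rfl).ge, hp⟩
            · refine ⟨y, hy, fun t ht => ?_, ?_, hp⟩
              · have : t ≠ t₀ := by rintro rfl; simp [ht₀] at ht
                simpa [this] using h t ht
              · simp at h'; omega
          · rintro ⟨y, hy, h, h', hp⟩
            rcases Nat.eq_or_lt_of_le h' with h'' | h''
            · refine Or.inl ⟨y, hy, fun t ht => ?_, hp⟩
              rcases Nat.eq_or_lt_of_le ht with e' | e'
              · obtain rfl : t = t₀ := Fin.ext e'.symm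
                exact h''.symm
              · exact h t e'
            · refine Or.inr ⟨y, hy, fun t ht => ?_, by simpa using h'', hp⟩
              have : t ≠ t₀ := by rintro rfl; simp [ht₀] at ht
              simpa [this] using h t ht
    have hn := hx t₀
    have hx0 : x t₀ = 0 := h0 t₀ (Nat.lt_succ_self e)
    obtain ⟨f', h1, h2⟩ := key (n - 1) x f hx (fun t ht => h0 t (by omega)) (by omega)
    refine ⟨f', ?_, h2.trans (or_congr Iff.rfl (exists_congr fun y => ?_))⟩
    · rw [← hx0, Function.update_eq_self, Nat.sub_add_cancel (by omega)] at h1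
      exact h1.mono (Nat.mul_le_mul_right _ hnL)
    · simp [hx0]

/-! ### Total running time and correctness -/

/-- The running time of the machine. -/
def totalTime (k L : ℕ) : ℕ := 3 * L + 10 + loopTime L k

/-- Each nested loop costs one more factor `L`; their number `k` is fixed, so the bound is
polynomial. -/
lemma exists_eval_totalTime (k : ℕ) : ∃ p : Polynomial ℕ, ∀ L, p.eval L = totalTime k L := by
  have h : ∀ e, ∃ p : Polynomial ℕ, ∀ L, p.eval L = loopTime L e := by
    intro e
    induction e with
    | zero =>
      exact ⟨Polynomial.X * (2 * Polynomial.X + 4) + 2, fun L => by simp [loopTime]⟩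
    | succ e ih =>
      obtain ⟨p, hp⟩ := ih
      exact ⟨Polynomial.X * (p + (3 * Polynomial.X + 5)), fun L => by simp [loopTime, hp]⟩
  obtain ⟨p, hp⟩ := h k
  exact ⟨3 * Polynomial.X + 10 + p, fun L => by simp [totalTime, hp]⟩

lemma runs_total (hk : 0 < k) (n : ℕ) (b : ℕ → ℕ → Bool) :
    ∃ f, Runs P ⟨some .setup, {}, tapes (matCode (List.range n) (List.range n) b) [] [] [] [] [] []⟩
        ⟨none, {}, tapes [] [] [] [] [] [] [!f]⟩ (totalTime k (n * (n + 1))) ∧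
      (f = true ↔ ∃ y : Fin k → ℕ, (∀ t, y t < n) ∧ P (fun s t => b (y s) (y t)) = true) := by
  rcases n with _ | n
  -- On the graph without vertices `P` is never evaluated, which is correct since `0 < k` leaves no
  -- tuple.
  · refine ⟨false, ?_, ?_⟩
    · refine Runs.mono (Runs.head (b := ⟨some .fin, {}, tapes [] [] [] [] [] [] []⟩) ?_
        (runs_fin false [] _ (by simp))) (by simp [totalTime]; omega)
      simp [prog, goClear, Mem.clear, matCode]
    · simp only [Bool.false_eq_true, false_iff]
      rintro ⟨y, hy, -⟩
      exact absurd (hy ⟨0, hk⟩) (by simp)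
  · obtain ⟨f, h1, h2⟩ := runs_loop (P := P) (b := b) (le_refl ((n + 1) * (n + 1 + 1))) k le_rfl
      (fun _ => 0) false (fun _ => Nat.succ_pos n) (fun _ _ => rfl)
    refine ⟨f, ?_, h2.trans ?_⟩
    · have h3 : Runs P
          ⟨some .setup, {}, tapes (matCode (List.range (n + 1)) (List.range (n + 1)) b)
            [] [] [] [] [] []⟩ (ready (n + 1) b (fun _ => 0) false) (2 * n + 5) := by
        have h4 := runs_setup (P := P) false (fun _ _ => false) (b 0 0)
          (((List.range n).map Nat.succ).map (b 0))
          (i := matCode ((List.range n).map Nat.succ) (List.range (n + 1)) b)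
        have h5 : matCode (List.range (n + 1)) (List.range (n + 1)) b =
            ((b 0 0) :: ((List.range n).map Nat.succ).map (b 0)).map some ++
              none :: matCode ((List.range n).map Nat.succ) (List.range (n + 1)) b := by
          conv_lhs => rw [matCode, List.range_succ_eq_map, List.flatMap_cons]
          simp [matCode, rowCode, List.range_succ_eq_map, Function.comp_def]
        have h6 : tupleWord (n + 1) (fun _ : Fin k => 0) =
            (fun _ => true) :: List.replicate n (noMarks k) := by
          rw [tupleWord, List.range_succ_eq_map, List.map_cons, List.map_map]
          congr 1
          rw [List.eq_replicate_iff]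
          simp [Function.comp_def, funext_iff]
        rw [ready, h5, h6]
        simpa using h4
      have h7 := runs_fin (P := P) f (tupleWord (n + 1) (fun _ : Fin k => 0)) (fun _ _ => false)
        (d := (matCode (List.range (n + 1)) (List.range (n + 1)) b).reverse)
        (by simp only [List.length_reverse, length_matCode, List.length_range, length_tupleWord]
            nlinarith)
      have h8 : checked (n + 1) b k (fun _ : Fin k => 0) f = ⟨some .fin, ⟨none, none, noMarks k,
          fun _ _ => false, f⟩,
          tapes [] (matCode (List.range (n + 1)) (List.range (n + 1)) b).reverse (tupleWord (n + 1) (fun _ : Fin k => 0)) [] (tupleWord (n + 1) (fun _ : Fin k => 0))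
          [] []⟩ := by
        simp [checked, incLab]
      rw [h8] at h1
      refine ((h3.trans h1).trans h7).mono ?_
      simp only [List.length_reverse, length_matCode, List.length_range, totalTime]
      nlinarith
    · simp only [Bool.false_eq_true, false_or]
      refine exists_congr fun y => and_congr_right fun _ =>
        ⟨fun h => h.2, fun h => ⟨fun t ht => ?_, h⟩⟩
      exact absurd t.2 (by omega)

end TupleSearch

/-! ### Recognition by tuple search -/

open TupleSearch in
open Classical in
lemma encodeGraph_eq_matCode (G : InputGraph) :
    encodeGraph G = matCode (List.range G.1) (List.range G.1) fun i j =>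
      decide (∃ (hi : i < G.1) (hj : j < G.1), G.2.Adj ⟨i, hi⟩ ⟨j, hj⟩) := by
  simp only [encodeGraph, matCode, rowCode, ← List.map_coe_finRange_eq_range, List.flatMap_map,
    List.map_map]
  simp [Function.comp_def]

open TupleSearch in
/-- It can be decided in polynomial time whether some `k` vertices of a graph span an adjacency
matrix with the property `P`, hence also whether a graph has a property `Q` that is the negation
of this. -/
theorem recognizable_of_not_iff_exists_tuple {k : ℕ} (hk : 0 < k)
    (P : (Fin k → Fin k → Prop) → Prop) (Q : InputGraph → Prop)
    (hQ : ∀ G : InputGraph, ¬ Q G ↔ ∃ x : Fin k → Fin G.1, P fun s t => G.2.Adj (x s) (x t)) :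
    RecognizableInPolyTime Q := by
  classical
  -- On Boolean `k × k` matrices any predicate is a finite table, so it can be built into the
  -- program.
  set P' : (Fin k → Fin k → Bool) → Bool := fun a => decide (P fun s t => a s t = true) with hP'
  obtain ⟨p, hp⟩ := exists_eval_totalTime k
  refine ⟨fun G => decide (Q G), fun G => by simp, ⟨⟨machine P', Equiv.refl _, Equiv.refl _⟩, p,
    fun G => Classical.choice ?_⟩⟩
  obtain ⟨f, ⟨s, hs, hr⟩, hf⟩ := runs_total (P := P') hk G.1 fun i j =>
      decide (∃ (hi : i < G.1) (hj : j < G.1), G.2.Adj ⟨i, hi⟩ ⟨j, hj⟩)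
  have hfQ : (!f) = decide (Q G) := by
    rw [Bool.eq_iff_iff, Bool.not_eq_true', ← Bool.not_eq_true, hf, decide_eq_true_iff,
      not_iff_comm, hQ]
    constructor
    · rintro ⟨x, hx⟩
      exact ⟨fun t => x t, fun t => (x t).2, by simpa [hP'] using hx⟩
    · rintro ⟨y, hy, h⟩
      exact ⟨fun t => ⟨y t, hy t⟩, by simpa [hP', hy] using h⟩
  have hin : initList (machine P') (List.map (Equiv.refl (Option Bool)).invFun (encodeGraph G)) =
      (⟨some .setup, {}, tapes (encodeGraph G) [] [] [] [] [] []⟩ : Conf k) := by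
    simp only [initList]
    congr 1
    funext s
    cases s <;> first | rfl | (simp [machine, tapes]; rfl)
  have hout : haltList (machine P') (List.map (Equiv.refl Bool).invFun (encodeBool (decide (Q G)))) =
      (⟨none, {}, tapes [] [] [] [] [] [] [!f]⟩ : Conf k) := by
    rw [hfQ]
    simp only [haltList]
    congr 1
    funext s
    cases s <;> rfl
  refine ⟨⟨⟨s, ?_⟩, ?_⟩⟩
  · refine Eq.trans ?_ (hr.trans ?_)
    · rw [← encodeGraph_eq_matCode]
      exact congrArg (fun c => (flip bind (TM2.step (prog P')))^[s] (some c)) hin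
    · exact congrArg some hout.symm
  · rw [hp, length_encodeGraph]
    exact hs

/-! ### Berge's criterion -/

lemma exists_ne_ne_fin_three (i j : Fin 3) : ∃ l, l ≠ i ∧ l ≠ j := by decide +revert

section Berge

variable {α : Type*} {H : Hypergraph α}

/-- Berge's criterion: a finite hypergraph that is not Helly has three vertices such that the
hyperedges that contain at least two of them have no common element. -/
lemma exists_triple_of_not_isHelly (hfin : H.edgeSet.Finite) (h : ¬ IsHelly H) :
    ∃ a : Fin 3 → α, ∀ e, ∃ X ∈ H.edgeSet, e ∉ X ∧ ∃ i, ∀ j ≠ i, a j ∈ X := by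
  classical
  simp only [IsHelly, not_forall, Set.not_nonempty_iff_eq_empty] at h
  obtain ⟨F, hF, ⟨X₀, hX₀⟩, hpair, hemp⟩ := h
  -- A minimal subfamily with empty intersection has at least three members, as members of `F` meet
  -- pairwise. Dropping `X i` leaves a common point `a i`; thus every member of `t` misses at most
  -- one of the three points.
  obtain ⟨t, ht, hmin⟩ := exists_minimal_le_of_wellFoundedLT
    (fun t : Finset (Set α) => ⋂₀ (t : Set (Set α)) = ∅) (hfin.subset hF).toFinset (by simpa)
  have htF : ∀ X ∈ t, X ∈ F := fun X hX => by simpa using ht hX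
  have hcard : 2 < t.card := by
    by_contra hc
    have hc' : t.card = 0 ∨ t.card = 1 ∨ t.card = 2 := by omega
    have hp := hmin.prop
    rcases hc' with hc | hc | hc
    · obtain rfl := Finset.card_eq_zero.1 hc
      obtain ⟨x, -⟩ := hpair X₀ hX₀ X₀ hX₀
      simp only [Finset.coe_empty, Set.sInter_empty] at hp
      exact (Set.mem_empty_iff_false x).1 (hp ▸ Set.mem_univ x)
    · obtain ⟨X, rfl⟩ := Finset.card_eq_one.1 hc
      obtain ⟨x, hx, -⟩ := hpair X (htF X (by simp)) X (htF X (by simp))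
      simp only [Finset.coe_singleton, Set.sInter_singleton] at hp
      simp [hp] at hx
    · obtain ⟨X, Y, -, rfl⟩ := Finset.card_eq_two.1 hc
      have := hpair X (htF X (by simp)) Y (htF Y (by simp))
      simp only [Finset.coe_pair, Set.sInter_pair] at hp
      simp [hp] at this
  obtain ⟨X₁, h₁, X₂, h₂, X₃, h₃, h₁₂, h₁₃, h₂₃⟩ := Finset.two_lt_card.1 hcard
  have hX : ∃ X : Fin 3 → Set α, Function.Injective X ∧ ∀ i, X i ∈ t := by
    refine ⟨![X₁, X₂, X₃], fun i j hij => ?_, fun i => ?_⟩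
    · fin_cases i <;> fin_cases j <;> simp_all
    · fin_cases i <;> simp_all
  obtain ⟨X, hinj, hXt⟩ := hX
  have ha : ∀ i, ∃ a, ∀ Y ∈ t, Y ≠ X i → a ∈ Y := by
    intro i
    have := hmin.not_prop_of_lt (Finset.erase_ssubset (hXt i))
    obtain ⟨a, ha⟩ := Set.nonempty_iff_ne_empty.2 this
    exact ⟨a, fun Y hY hne => ha Y (by simp [hY, hne])⟩
  choose a ha using ha
  refine ⟨a, fun e => ?_⟩
  have he : e ∉ ⋂₀ (t : Set (Set α)) := by rw [hmin.prop]; simp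
  obtain ⟨Y, hY, heY⟩ : ∃ Y ∈ t, e ∉ Y := by simpa using he
  refine ⟨Y, hF (htF Y hY), heY, ?_⟩
  by_cases hi : ∃ i, Y = X i
  · obtain ⟨i, rfl⟩ := hi
    exact ⟨i, fun j hj => ha j _ hY fun h => hj (hinj h).symm⟩
  · exact ⟨0, fun j _ => ha j _ hY fun h => hi ⟨j, h⟩⟩

/-- Two hyperedges that each contain two of three given vertices share one of these, so all such
hyperedges meet pairwise. -/
lemma not_isHelly_of_triple (a : Fin 3 → α)
    (h : ∀ e, ∃ X ∈ H.edgeSet, e ∉ X ∧ ∃ i, ∀ j ≠ i, a j ∈ X) : ¬ IsHelly H := by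
  intro hH
  obtain ⟨e, he⟩ := hH {X | X ∈ H.edgeSet ∧ ∃ i, ∀ j ≠ i, a j ∈ X} (fun X hX => hX.1)
    (let ⟨X, hX, _, hi⟩ := h (a 0); ⟨X, hX, hi⟩) (by
      rintro X ⟨-, i, hi⟩ Y ⟨-, i', hi'⟩
      obtain ⟨j, hj, hj'⟩ := exists_ne_ne_fin_three i i'
      exact ⟨a j, hi j hj, hi' j hj'⟩)
  obtain ⟨X, hX, heX, hi⟩ := h e
  exact heX (he X ⟨hX, hi⟩)

end Berge

/-! ### Complete bipartite sets through a given edge -/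

section CompleteBipartite

variable {V : Type*} {G : SimpleGraph V} {X Y : Set V} {p q : V}

/-- Adjacency to `p` tells on which side a vertex lies, and two vertices are adjacent iff their
sides differ. The condition concerns pairs only, whence heredity, locality and invariance under
pullback. -/
lemma inducesCompleteBipartite_iff (hp : p ∈ X) (hq : q ∈ X) (hpq : G.Adj p q) :
    InducesCompleteBipartite G X ↔
      ∀ x ∈ X, ∀ y ∈ X, (G.Adj x y ↔ ¬ (G.Adj p x ↔ G.Adj p y)) := by
  constructor
  · rintro ⟨S, T, -, -, rfl, hS, hT, hST⟩
    have key : ∃ c : V → Prop, ∀ x ∈ S ∪ T, ∀ y ∈ S ∪ T, (G.Adj x y ↔ ¬ (c x ↔ c y)) := by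
      have hd : ∀ x ∈ T, x ∉ S := fun x hx hx' => G.irrefl (hST hx' hx)
      refine ⟨fun x => x ∈ S, ?_⟩
      rintro x (hx | hx) y (hy | hy)
      · simp only [hx, hy, iff_self, not_true, iff_false]
        intro h; exact hS hx hy h.ne h
      · simp [hx, hd y hy, hST hx hy]
      · simp [hy, hd x hx, (hST hy hx).symm]
      · simp only [hd x hx, hd y hy, iff_self, not_true, iff_false]
        intro h; exact hT hx hy h.ne h
    obtain ⟨c, hc⟩ := key
    intro x hx y hy
    rw [hc x hx y hy, hc p hp x hx, hc p hp y hy]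
    tauto
  · intro h
    refine ⟨{x | x ∈ X ∧ ¬ G.Adj p x}, {x | x ∈ X ∧ G.Adj p x}, ⟨p, hp, G.irrefl⟩, ⟨q, hq, hpq⟩,
      ?_, ?_, ?_, ?_⟩
    · ext x; simp only [Set.mem_union, Set.mem_ofPred_eq]; tauto
    · rintro x ⟨hx, hx'⟩ y ⟨hy, hy'⟩ - hxy
      have := (h x hx y hy).1 hxy; tauto
    · rintro x ⟨hx, hx'⟩ y ⟨hy, hy'⟩ - hxy
      have := (h x hx y hy).1 hxy; tauto
    · rintro x ⟨hx, hx'⟩ y ⟨hy, hy'⟩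
      exact (h x hx y hy).2 (by tauto)

lemma InducesCompleteBipartite.mono (h : InducesCompleteBipartite G X) (hYX : Y ⊆ X)
    (hp : p ∈ Y) (hq : q ∈ Y) (hpq : G.Adj p q) : InducesCompleteBipartite G Y :=
  (inducesCompleteBipartite_iff hp hq hpq).2 fun x hx y hy =>
    (inducesCompleteBipartite_iff (hYX hp) (hYX hq) hpq).1 h x (hYX hx) y (hYX hy)

/-- Being complete bipartite is a local property. -/
lemma inducesCompleteBipartite_of_forall_pair (hp : p ∈ X) (hq : q ∈ X) (hpq : G.Adj p q)
    (h : ∀ x ∈ X, ∀ y ∈ X, ∃ Y, p ∈ Y ∧ q ∈ Y ∧ x ∈ Y ∧ y ∈ Y ∧ InducesCompleteBipartite G Y) :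
    InducesCompleteBipartite G X := by
  rw [inducesCompleteBipartite_iff hp hq hpq]
  intro x hx y hy
  obtain ⟨Y, hpY, hqY, hxY, hyY, hY⟩ := h x hx y hy
  exact (inducesCompleteBipartite_iff hpY hqY hpq).1 hY x hxY y hyY

/-- The criterion sees vertices only through adjacency, so `f` may identify some of them. -/
lemma inducesCompleteBipartite_comap {ι : Type*} (f : ι → V) {Z : Set ι} {s t : ι} (hs : s ∈ Z)
    (ht : t ∈ Z) (hst : G.Adj (f s) (f t)) :
    InducesCompleteBipartite (G.comap f) Z ↔ InducesCompleteBipartite G (f '' Z) := by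
  rw [inducesCompleteBipartite_iff (G := G.comap f) hs ht hst,
    inducesCompleteBipartite_iff (Set.mem_image_of_mem f hs) (Set.mem_image_of_mem f ht) hst]
  simp

lemma InducesCompleteBipartite.exists_isBiclique [Finite V] (h : InducesCompleteBipartite G X) :
    ∃ B, X ⊆ B ∧ IsBiclique G B := by
  obtain ⟨B, hB, hmax⟩ := exists_maximal_ge_of_wellFoundedGT (InducesCompleteBipartite G) X h
  exact ⟨B, hB, hmax⟩

@[simp] lemma mk_mem_inducedEdges {x y : V} :
    s(x, y) ∈ inducedEdges G X ↔ G.Adj x y ∧ x ∈ X ∧ y ∈ X := by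
  simp [inducedEdges]

end CompleteBipartite

/-! ### Three edges and their ends -/

section Triples

/-- The six ends of three edges. -/
abbrev Ends : Type := Fin 3 × Bool

/-- The ends of two of the three edges, without the edge `i`. -/
def endsExcept (i : Fin 3) : Set Ends := {s | s.1 ≠ i}

variable {V : Type*} {G : SimpleGraph V} {w : Ends → V}

/-- If a fourth edge is in a common complete bipartite subgraph with any two of three edges, it is
in a common one with all three. -/
lemma inducesCompleteBipartite_range_union {p q : V} (hpq : G.Adj p q)
    (h : ∀ i, InducesCompleteBipartite G (w '' endsExcept i ∪ {p, q})) :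
    InducesCompleteBipartite G (Set.range w ∪ {p, q}) := by
  refine inducesCompleteBipartite_of_forall_pair (p := p) (q := q) (by simp) (by simp) hpq ?_
  have key : ∀ x ∈ Set.range w ∪ {p, q}, ∃ j : Fin 3, ∀ i ≠ j, x ∈ w '' endsExcept i ∪ {p, q} := by
    rintro x (⟨s, rfl⟩ | hx)
    · exact ⟨s.1, fun i hi => Or.inl ⟨s, hi.symm, rfl⟩⟩
    · exact ⟨0, fun i _ => Or.inr hx⟩
  intro x hx y hy
  obtain ⟨j, hj⟩ := key x hx
  obtain ⟨j', hj'⟩ := key y hy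
  obtain ⟨i, hi, hi'⟩ := exists_ne_ne_fin_three j j'
  exact ⟨_, by simp, by simp, hj i hi, hj' i hi', h i⟩

lemma exists_ends (a : Fin 3 → Sym2 V) (ha : ∀ i, a i ∈ G.edgeSet) :
    ∃ w : Ends → V, (∀ i, a i = s(w (i, false), w (i, true))) ∧
      ∀ i, G.Adj (w (i, false)) (w (i, true)) := by
  have : ∀ i, ∃ p : V × V, a i = s(p.1, p.2) := fun i => by
    induction a i with
    | _ x y => exact ⟨(x, y), rfl⟩
  choose p hp using this
  refine ⟨fun s => bif s.2 then (p s.1).2 else (p s.1).1, fun i => by simp [hp], fun i => ?_⟩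
  have := ha i
  rw [hp] at this
  simpa using this

lemma image_endsExcept_subset {X : Set V} {i : Fin 3}
    (h : ∀ j ≠ i, s(w (j, false), w (j, true)) ∈ inducedEdges G X) : w '' endsExcept i ⊆ X := by
  rintro _ ⟨⟨j, b⟩, hj, rfl⟩
  have := mk_mem_inducedEdges.1 (h j hj)
  cases b
  exacts [this.2.1, this.2.2]

end Triples

/-! ### Forbidden patterns for the Helly property of induced subgraphs -/

variable {V : Type*} {G : SimpleGraph V}

/-- A pattern on twelve vertices: three edges, the ends of which are indexed by `Sum.inl`, and for
each `i` an edge that is in a common complete bipartite subgraph with the other two of them, but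
not with all three. -/
def HereditaryHellyObstruction (H : SimpleGraph (Ends ⊕ Ends)) : Prop :=
  (∀ i, H.Adj (.inl (i, false)) (.inl (i, true))) ∧
  (∀ i, H.Adj (.inr (i, false)) (.inr (i, true))) ∧
  ∀ i, InducesCompleteBipartite H
      (Sum.inl '' endsExcept i ∪ {.inr (i, false), .inr (i, true)}) ∧
    ¬ InducesCompleteBipartite H (Set.range Sum.inl ∪ {.inr (i, false), .inr (i, true)})

/-- A pattern of edges `a i`, together with some more vertices, in which no edge is in every
biclique that contains two of the edges `a i`. -/
def HellyObstruction (H : SimpleGraph (Ends ⊕ Ends × Ends)) : Prop :=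
  (∀ i, H.Adj (.inl (i, false)) (.inl (i, true))) ∧
  ∀ s t, H.Adj s t → ∃ i Z, InducesCompleteBipartite H Z ∧ Sum.inl '' endsExcept i ⊆ Z ∧
    ¬ InducesCompleteBipartite H (Z ∪ {s, t})

lemma finite_edgeSet_edgeBicliqueHypergraph [Finite V] : (edgeBicliqueHypergraph G).edgeSet.Finite :=
  Set.toFinite _

/-- If the biclique `X` does not contain both `u` and `u'`, then some `v ∈ X` shows why: no complete
bipartite set contains `v`, `u`, `u'` and a given edge of `X`. -/
lemma exists_vertex_of_notMem_biclique {X : Set V} {p q u u' : V} (hX : IsBiclique G X)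
    (hp : p ∈ X) (hq : q ∈ X) (hpq : G.Adj p q) (hu : ¬ (u ∈ X ∧ u' ∈ X)) :
    ∃ v ∈ X, ∀ Y, p ∈ Y → q ∈ Y → v ∈ Y → u ∈ Y → u' ∈ Y → ¬ InducesCompleteBipartite G Y := by
  wlog h : u ∉ X generalizing u u'
  · obtain ⟨v, hv, h'⟩ := this (u := u') (u' := u) (by tauto) (by tauto)
    exact ⟨v, hv, fun Y h1 h2 h3 h4 h5 => h' Y h1 h2 h3 h5 h4⟩
  -- If no `v` works, every pair in `insert u X` passes the local test, against the maximality of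
  -- `X`.
  by_contra! hc
  refine h (hX.2 (y := insert u X) ?_ (Set.subset_insert _ _) (Set.mem_insert _ _))
  rw [inducesCompleteBipartite_iff (Set.mem_insert_of_mem _ hp) (Set.mem_insert_of_mem _ hq) hpq]
  have hXX := (inducesCompleteBipartite_iff hp hq hpq).1 hX.prop
  have huX : ∀ x ∈ X, (G.Adj x u ↔ ¬ (G.Adj p x ↔ G.Adj p u)) := by
    intro x hx
    obtain ⟨Y, h1, h2, h3, h4, -, h6⟩ := hc x hx
    exact (inducesCompleteBipartite_iff h1 h2 hpq).1 h6 x h3 u h4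
  rintro x (rfl | hx) y (rfl | hy)
  · simp
  · rw [G.adj_comm, huX y hy]; tauto
  · exact huX x hx
  · exact hXX x hx y hy

lemma exists_hellyObstruction [Finite V] (h : ¬ IsHelly (edgeBicliqueHypergraph G)) :
    ∃ x : Ends ⊕ Ends × Ends → V, HellyObstruction (G.comap x) := by
  obtain ⟨a, ha⟩ := exists_triple_of_not_isHelly finite_edgeSet_edgeBicliqueHypergraph h
  have hB : ∀ e, ∃ X, IsBiclique G X ∧ e ∉ inducedEdges G X ∧
      ∃ i, ∀ j ≠ i, a j ∈ inducedEdges G X := by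
    intro e
    obtain ⟨_, ⟨X, hX, rfl⟩, h1, h2⟩ := ha e
    exact ⟨X, hX, h1, h2⟩
  have hBi : ∀ i, ∃ X, IsBiclique G X ∧ a i ∉ inducedEdges G X ∧
      ∀ j ≠ i, a j ∈ inducedEdges G X := by
    intro i
    obtain ⟨X, hX, h1, l, hl⟩ := hB (a i)
    obtain rfl : i = l := by by_contra hil; exact h1 (hl i hil)
    exact ⟨X, hX, h1, hl⟩
  have haE : ∀ i, a i ∈ G.edgeSet := by
    intro i
    obtain ⟨j, hj, -⟩ := exists_ne_ne_fin_three i i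
    obtain ⟨X, -, -, hX⟩ := hBi j
    exact (hX i hj.symm).1
  obtain ⟨w, hw, hadj⟩ := exists_ends a haE
  simp only [hw] at hB hBi
  have hK : ∀ s t, G.Adj (w s) (w t) → ∃ v i,
      InducesCompleteBipartite G (w '' endsExcept i ∪ {v}) ∧
      ¬ InducesCompleteBipartite G (w '' endsExcept i ∪ {v} ∪ {w s, w t}) := by
    intro s t hst
    obtain ⟨X, hX, h1, i, hi⟩ := hB s(w s, w t)
    obtain ⟨j, hj, -⟩ := exists_ne_ne_fin_three i i
    have hsub := image_endsExcept_subset hi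
    have hmem : ∀ b, w (j, b) ∈ w '' endsExcept i := fun b => ⟨(j, b), hj, rfl⟩
    obtain ⟨v, hv, hv'⟩ := exists_vertex_of_notMem_biclique (u := w s) (u' := w t) hX
      (hsub (hmem false)) (hsub (hmem true)) (hadj j) (by simpa [hst] using h1)
    refine ⟨v, i, hX.prop.mono (p := w (j, false)) (q := w (j, true)) ?_ (Or.inl (hmem false))
      (Or.inl (hmem true)) (hadj j), ?_⟩
    · exact Set.union_subset hsub (by simpa using hv)
    · exact hv' _ (Or.inl (Or.inl (hmem false))) (Or.inl (Or.inl (hmem true))) (by simp)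
        (by simp) (by simp)
  have hv : ∀ st : Ends × Ends, ∃ v, ¬ InducesCompleteBipartite G (Set.range w ∪ {v}) ∧
      (G.Adj (w st.1) (w st.2) → ∃ i, InducesCompleteBipartite G (w '' endsExcept i ∪ {v}) ∧
      ¬ InducesCompleteBipartite G (w '' endsExcept i ∪ {v} ∪ {w st.1, w st.2})) := by
    have hK' : ∀ s t v i, ¬ InducesCompleteBipartite G (w '' endsExcept i ∪ {v} ∪ {w s, w t}) →
        ¬ InducesCompleteBipartite G (Set.range w ∪ {v}) := by
      intro s t v i hn hc
      obtain ⟨j, hj, -⟩ := exists_ne_ne_fin_three i i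
      refine hn (hc.mono (p := w (j, false)) (q := w (j, true)) ?_
        (Or.inl (Or.inl ⟨_, hj, rfl⟩)) (Or.inl (Or.inl ⟨_, hj, rfl⟩)) (hadj j))
      rintro x ((⟨y, -, rfl⟩ | hx) | (rfl | rfl))
      exacts [Or.inl ⟨_, rfl⟩, Or.inr hx, Or.inl ⟨_, rfl⟩, Or.inl ⟨_, rfl⟩]
    rintro ⟨s, t⟩
    by_cases hst : G.Adj (w s) (w t)
    · obtain ⟨v, i, h1, h2⟩ := hK s t hst
      exact ⟨v, hK' _ _ _ _ h2, fun _ => ⟨i, h1, h2⟩⟩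
    -- A pair of nonadjacent ends needs no witness; it borrows one, so that `hvU` holds for all
    -- extra vertices.
    · obtain ⟨v, i, h1, h2⟩ := hK _ _ (hadj 0)
      exact ⟨v, hK' _ _ _ _ h2, fun h => absurd h hst⟩
  choose v hvU hv using hv
  set x : Ends ⊕ Ends × Ends → V := Sum.elim w v with hx
  have hximg : ∀ i, x '' (Sum.inl '' endsExcept i) = w '' endsExcept i := by
    intro i; rw [Set.image_image]; rfl
  have hcomap : ∀ i Z, Sum.inl '' endsExcept i ⊆ Z →
      (InducesCompleteBipartite (G.comap x) Z ↔ InducesCompleteBipartite G (x '' Z)) := by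
    intro i Z hZ
    obtain ⟨j, hj, -⟩ := exists_ne_ne_fin_three i i
    exact inducesCompleteBipartite_comap x (s := .inl (j, false)) (t := .inl (j, true))
      (hZ ⟨_, hj, rfl⟩) (hZ ⟨_, hj, rfl⟩) (hadj j)
  refine ⟨x, hadj, fun s' t' hst => ?_⟩
  replace hst : G.Adj (x s') (x t') := hst
  -- An edge compatible with all three `a i` avoids the extra vertices by `hvU`, so it joins two
  -- ends and has its own witness. Otherwise it is incompatible with some two of the `a i`, and no
  -- extra vertex is needed.
  by_cases hU : InducesCompleteBipartite G (Set.range w ∪ {x s', x t'})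
  · have hno : ∀ u : Ends × Ends, x (.inr u) ∉ ({x s', x t'} : Set V) := by
      intro u hu
      exact hvU u (hU.mono (p := w (0, false)) (q := w (0, true))
        (Set.union_subset_union_right _ (Set.singleton_subset_iff.2 hu)) (by simp) (by simp) (hadj 0))
    rcases s' with s | u
    swap
    · exact absurd (by simp) (hno u)
    rcases t' with t | u
    swap
    · exact absurd (by simp) (hno u)
    obtain ⟨i, h1, h2⟩ := hv (s, t) hst
    refine ⟨i, Sum.inl '' endsExcept i ∪ {.inr (s, t)}, ?_, Set.subset_union_left, ?_⟩
    · rw [hcomap i _ Set.subset_union_left, Set.image_union, hximg, Set.image_singleton]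
      exact h1
    · rw [hcomap i _ (Set.subset_union_left.trans Set.subset_union_left), Set.image_union,
        Set.image_union, hximg, Set.image_singleton, Set.image_pair]
      exact h2
  · obtain ⟨i, hi⟩ : ∃ i, ¬ InducesCompleteBipartite G (w '' endsExcept i ∪ {x s', x t'}) := by
      by_contra! hc
      exact hU (inducesCompleteBipartite_range_union hst hc)
    refine ⟨i, Sum.inl '' endsExcept i, ?_, subset_rfl, ?_⟩
    · rw [hcomap i _ subset_rfl, hximg]
      obtain ⟨X, hX, -, hi'⟩ := hBi i
      obtain ⟨j, hj, -⟩ := exists_ne_ne_fin_three i i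
      exact hX.prop.mono (image_endsExcept_subset hi') (p := w (j, false)) (q := w (j, true))
        ⟨_, hj, rfl⟩ ⟨_, hj, rfl⟩ (hadj j)
    · rw [hcomap i _ Set.subset_union_left, Set.image_union, hximg, Set.image_pair]
      exact hi

/-- By surjectivity every edge is covered by the pattern. Any biclique that extends the set `Z`
given for it misses this edge, because complete bipartiteness passes to subsets containing an edge.
-/
lemma not_isHelly_of_hellyObstruction [Finite V] {x : Ends ⊕ Ends × Ends → V}
    (hsurj : Function.Surjective x) (h : HellyObstruction (G.comap x)) :
    ¬ IsHelly (edgeBicliqueHypergraph G) := by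
  obtain ⟨hadj, hobs⟩ := h
  have hadj' : ∀ i, G.Adj (x (.inl (i, false))) (x (.inl (i, true))) := hadj
  have hE : ∀ s t, G.Adj (x s) (x t) → ∃ X ∈ (edgeBicliqueHypergraph G).edgeSet,
      s(x s, x t) ∉ X ∧ ∃ i, ∀ j ≠ i, s(x (.inl (j, false)), x (.inl (j, true))) ∈ X := by
    intro s t hst
    obtain ⟨i, Z, hZ, hiZ, hnZ⟩ := hobs s t hst
    obtain ⟨j, hj, -⟩ := exists_ne_ne_fin_three i i
    have hm : ∀ j ≠ i, ∀ b, .inl (j, b) ∈ Z := fun j hj b => hiZ ⟨(j, b), hj, rfl⟩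
    rw [inducesCompleteBipartite_comap x (hm j hj false) (hm j hj true) (hadj' j)] at hZ
    rw [inducesCompleteBipartite_comap x (Or.inl (hm j hj false)) (Or.inl (hm j hj true))
      (hadj' j)] at hnZ
    obtain ⟨B, hZB, hB⟩ := hZ.exists_isBiclique
    refine ⟨_, ⟨B, hB, rfl⟩, fun he => hnZ ?_, i, fun l hl => ?_⟩
    · refine hB.prop.mono (p := x (.inl (j, false))) (q := x (.inl (j, true))) ?_
        ⟨_, Or.inl (hm j hj false), rfl⟩ ⟨_, Or.inl (hm j hj true), rfl⟩ (hadj' j)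
      have he' := mk_mem_inducedEdges.1 he
      rw [Set.image_union, Set.image_pair]
      refine Set.union_subset hZB ?_
      rintro y (rfl | rfl)
      exacts [he'.2.1, he'.2.2]
    · exact mk_mem_inducedEdges.2 ⟨hadj' l, hZB ⟨_, hm l hl false, rfl⟩, hZB ⟨_, hm l hl true, rfl⟩⟩
  refine not_isHelly_of_triple (fun i => s(x (.inl (i, false)), x (.inl (i, true)))) fun e => ?_
  by_cases he : e ∈ G.edgeSet
  · induction e with
    | _ u u' =>
      obtain ⟨s, rfl⟩ := hsurj u
      obtain ⟨t, rfl⟩ := hsurj u'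
      exact hE s t he
  · obtain ⟨X, hX, -, hi⟩ := hE _ _ (hadj' 0)
    exact ⟨X, hX, fun heX =>
      he ((edgeBicliqueHypergraph G).subset_vertexSet_of_mem_edgeSet' hX heX), hi⟩

theorem not_forall_induce_isHelly_iff [Finite V] :
    (¬ ∀ S : Set V, IsHelly (edgeBicliqueHypergraph (G.induce S))) ↔
      ∃ x : Ends ⊕ Ends × Ends → V, HellyObstruction (G.comap x) := by
  rw [not_forall]
  constructor
  · rintro ⟨S, hS⟩
    obtain ⟨x, hx⟩ := exists_hellyObstruction hS
    exact ⟨fun i => x i, hx⟩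
  · rintro ⟨x, hx⟩
    exact ⟨Set.range x, not_isHelly_of_hellyObstruction (x := Set.rangeFactorization x)
      Set.rangeFactorization_surjective hx⟩

/-! ### Forbidden patterns for the hereditary Helly property -/

/-- The hyperedges of the reduction of an induced subhypergraph of `EB(G)`. -/
lemma mem_edgeSet_reduction_induced {A X : Set (Sym2 V)} :
    X ∈ (reduction (inducedSubhypergraph (edgeBicliqueHypergraph G) A)).edgeSet ↔
      Maximal (fun Y => Y.Nonempty ∧ ∃ B, IsBiclique G B ∧ Y = inducedEdges G B ∩ A) X := by
  simp only [reduction, inducedSubhypergraph, edgeBicliqueHypergraph]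
  refine Eq.to_iff (congrArg (fun p => Maximal p X) (funext fun Y => ?_))
  simp only [Set.mem_ofPred_eq, eq_iff_iff]
  refine and_congr_right fun _ => ⟨?_, ?_⟩
  · rintro ⟨_, ⟨B, hB, rfl⟩, h⟩
    exact ⟨B, hB, h⟩
  · rintro ⟨B, hB, h⟩
    exact ⟨_, ⟨B, hB, rfl⟩, h⟩

lemma exists_hereditaryHellyObstruction [Finite V]
    (h : ¬ IsHereditaryHelly (edgeBicliqueHypergraph G)) :
    ∃ x : Ends ⊕ Ends → V, HereditaryHellyObstruction (G.comap x) := by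
  simp only [IsHereditaryHelly, not_forall] at h
  obtain ⟨A, hA, h⟩ := h
  obtain ⟨a, ha⟩ := exists_triple_of_not_isHelly (Set.toFinite _) h
  simp only [mem_edgeSet_reduction_induced] at ha
  have hB : ∀ i, ∃ B, IsBiclique G B ∧ (∀ j ≠ i, a j ∈ inducedEdges G B ∩ A) ∧
      a i ∉ inducedEdges G B ∩ A ∧ Maximal (fun Y => Y.Nonempty ∧ ∃ B, IsBiclique G B ∧
        Y = inducedEdges G B ∩ A) (inducedEdges G B ∩ A) := by
    intro i
    obtain ⟨X, hX, hiX, l, hl⟩ := ha (a i)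
    obtain rfl : i = l := by by_contra hil; exact hiX (hl i hil)
    obtain ⟨-, B, hB, rfl⟩ := hX.prop
    exact ⟨B, hB, hl, hiX, hX⟩
  have haA : ∀ i, a i ∈ A := by
    intro i
    obtain ⟨j, hj, -⟩ := exists_ne_ne_fin_three i i
    obtain ⟨B, -, hB, -⟩ := hB j
    exact (hB i hj.symm).2
  obtain ⟨w, hw, hadj⟩ := exists_ends a fun i => hA (haA i)
  have hv : ∀ i, ∃ v : V × V, G.Adj v.1 v.2 ∧
      InducesCompleteBipartite G (w '' endsExcept i ∪ {v.1, v.2}) ∧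
      ¬ InducesCompleteBipartite G (Set.range w ∪ {v.1, v.2}) := by
    intro i
    obtain ⟨B, hB, hi, hni, hmax⟩ := hB i
    obtain ⟨j, hj, -⟩ := exists_ne_ne_fin_three i i
    have hsub : w '' endsExcept i ⊆ B :=
      image_endsExcept_subset fun l hl => by rw [← hw]; exact (hi l hl).1
    -- Otherwise each edge in the trace of `B` is compatible with all three `a j`. It will follow
    -- that some biclique has a trace that contains the old one and `a i`.
    by_contra! hc
    have hall : ∀ y z, s(y, z) ∈ inducedEdges G B ∩ A →
        InducesCompleteBipartite G (Set.range w ∪ {y, z}) := by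
      rintro y z ⟨h1, -⟩
      rw [mk_mem_inducedEdges] at h1
      refine hc (y, z) h1.1 (hB.prop.mono (p := y) (q := z) ?_ (by simp) (by simp) h1.1)
      refine Set.union_subset hsub ?_
      rintro u (rfl | rfl)
      exacts [h1.2.1, h1.2.2]
    have hjA : s(w (j, false), w (j, true)) ∈ inducedEdges G B ∩ A := by rw [← hw]; exact hi j hj
    have hrange : InducesCompleteBipartite G (Set.range w) :=
      (hall _ _ hjA).mono Set.subset_union_left (p := w (j, false)) (q := w (j, true))
        ⟨_, rfl⟩ ⟨_, rfl⟩ (hadj j)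
    set X : Set V := {u | ∃ e ∈ inducedEdges G B ∩ A, u ∈ e} ∪ Set.range w with hX
    have hXB : ∀ u, (∃ e ∈ inducedEdges G B ∩ A, u ∈ e) → u ∈ B :=
      fun u ⟨e, he, hu⟩ => he.1.2 u hu
    have hjB : ∀ b, w (j, b) ∈ B := fun b => hsub ⟨_, hj, rfl⟩
    have hmix : ∀ u, (∃ e ∈ inducedEdges G B ∩ A, u ∈ e) →
        InducesCompleteBipartite G (Set.range w ∪ {u}) := by
      rintro u ⟨e, he, hu⟩
      obtain ⟨z, rfl⟩ := hu
      exact (hall _ _ he).mono (Set.union_subset_union_right _ (by simp)) (p := w (j, false))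
        (q := w (j, true)) (by simp) (by simp) (hadj j)
    -- By locality only pairs matter: two ends of trace edges lie in `B`, mixed pairs are handled by
    -- `hmix`, and ends of the `a j` by `hrange`.
    have hXcb : InducesCompleteBipartite G X := by
      refine inducesCompleteBipartite_of_forall_pair (p := w (j, false)) (q := w (j, true))
        (Or.inr ⟨_, rfl⟩) (Or.inr ⟨_, rfl⟩) (hadj j) ?_
      rintro y (hy | hy) z (hz | hz)
      · exact ⟨B, hjB _, hjB _, hXB y hy, hXB z hz, hB.prop⟩
      · exact ⟨_, by simp, by simp, by simp, Or.inl hz, hmix y hy⟩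
      · exact ⟨_, by simp, by simp, Or.inl hy, by simp, hmix z hz⟩
      · exact ⟨Set.range w, ⟨_, rfl⟩, ⟨_, rfl⟩, hy, hz, hrange⟩
    obtain ⟨B', hXB', hB'⟩ := hXcb.exists_isBiclique
    have haB' : a i ∈ inducedEdges G B' ∩ A := by
      refine ⟨?_, haA i⟩
      rw [hw, mk_mem_inducedEdges]
      exact ⟨hadj i, hXB' (Or.inr ⟨_, rfl⟩), hXB' (Or.inr ⟨_, rfl⟩)⟩
    refine hni (hmax.2 ⟨⟨_, haB'⟩, B', hB', rfl⟩ ?_ haB')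
    exact fun e he => ⟨⟨he.1.1, fun u hu => hXB' (Or.inl ⟨e, he, hu⟩)⟩, he.2⟩
  choose v hv1 hv2 hv3 using hv
  set x : Ends ⊕ Ends → V := Sum.elim w fun s => bif s.2 then (v s.1).2 else (v s.1).1 with hx
  refine ⟨x, hadj, hv1, fun i => ⟨?_, fun hc => hv3 i ?_⟩⟩
  · rw [inducesCompleteBipartite_comap x (s := .inr (i, false)) (t := .inr (i, true)) (by simp)
      (by simp) (hv1 i), Set.image_union, Set.image_image, Set.image_pair]
    exact hv2 i
  · rw [inducesCompleteBipartite_comap x (s := .inr (i, false)) (t := .inr (i, true)) (by simp)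
      (by simp) (hv1 i), Set.image_union, ← Set.range_comp, Set.image_pair] at hc
    exact hc

lemma not_isHereditaryHelly_of_obstruction [Finite V] {x : Ends ⊕ Ends → V}
    (h : HereditaryHellyObstruction (G.comap x)) :
    ¬ IsHereditaryHelly (edgeBicliqueHypergraph G) := by
  obtain ⟨hadj, hadj', hobs⟩ := h
  set w : Ends → V := x ∘ Sum.inl with hw
  set v : Ends → V := x ∘ Sum.inr with hv
  replace hadj : ∀ i, G.Adj (w (i, false)) (w (i, true)) := hadj
  replace hadj' : ∀ i, G.Adj (v (i, false)) (v (i, true)) := hadj'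
  have h1 : ∀ i, InducesCompleteBipartite G (w '' endsExcept i ∪ {v (i, false), v (i, true)}) := by
    intro i
    have := (hobs i).1
    rwa [inducesCompleteBipartite_comap x (s := .inr (i, false)) (t := .inr (i, true)) (by simp)
      (by simp) (hadj' i), Set.image_union, Set.image_image, Set.image_pair] at this
  have h2 : ∀ i, ¬ InducesCompleteBipartite G (Set.range w ∪ {v (i, false), v (i, true)}) := by
    intro i
    have := (hobs i).2
    rwa [inducesCompleteBipartite_comap x (s := .inr (i, false)) (t := .inr (i, true)) (by simp)
      (by simp) (hadj' i), Set.image_union, ← Set.range_comp, Set.image_pair] at this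
  set a : Fin 3 → Sym2 V := fun i => s(w (i, false), w (i, true)) with ha
  set c : Fin 3 → Sym2 V := fun i => s(v (i, false), v (i, true)) with hc
  set A : Set (Sym2 V) := Set.range a ∪ Set.range c with hA
  have hAE : A ⊆ (edgeBicliqueHypergraph G).vertexSet := by
    rintro _ (⟨i, rfl⟩ | ⟨i, rfl⟩)
    exacts [hadj i, hadj' i]
  have hmax : ∀ i, ∃ X, Maximal (fun Y => Y.Nonempty ∧ ∃ B, IsBiclique G B ∧
      Y = inducedEdges G B ∩ A) X ∧ c i ∈ X ∧ ∀ j ≠ i, a j ∈ X := by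
    intro i
    obtain ⟨B, hB, hBic⟩ := (h1 i).exists_isBiclique
    have hci : c i ∈ inducedEdges G B ∩ A :=
      ⟨mk_mem_inducedEdges.2 ⟨hadj' i, hB (by simp), hB (by simp)⟩, Or.inr ⟨i, rfl⟩⟩
    obtain ⟨X, hX, hmax⟩ := exists_maximal_ge_of_wellFoundedGT (fun Y : Set (Sym2 V) =>
      Y.Nonempty ∧ ∃ B, IsBiclique G B ∧ Y = inducedEdges G B ∩ A) (inducedEdges G B ∩ A)
      ⟨⟨_, hci⟩, B, hBic, rfl⟩
    refine ⟨X, hmax, hX hci, fun j hj => hX ⟨mk_mem_inducedEdges.2 ⟨hadj j, ?_, ?_⟩,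
      Or.inl ⟨j, rfl⟩⟩⟩
    · exact hB (Or.inl ⟨_, hj, rfl⟩)
    · exact hB (Or.inl ⟨_, hj, rfl⟩)
  choose X hX hcX haX using hmax
  refine fun hH => not_isHelly_of_triple a ?_ (hH A hAE)
  simp only [mem_edgeSet_reduction_induced]
  intro e
  by_contra! hce
  have heX : ∀ i, e ∈ X i := by
    intro i
    by_contra he
    obtain ⟨j, hj, hj'⟩ := hce (X i) (hX i) he i
    exact hj' (haX i j hj)
  obtain ⟨-, B, -, hB⟩ := (hX 0).prop
  have heA : e ∈ A := by have := heX 0; rw [hB] at this; exact this.2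
  -- A common `a i` would put all three `a j` and `c i` into the biclique of `X i`. A common `c i`
  -- would be compatible with any two of the `a j`, hence with all three. The pattern excludes both.
  rcases heA with ⟨i, rfl⟩ | ⟨i, rfl⟩
  · obtain ⟨-, B, hBic, hB⟩ := (hX i).prop
    have hall : ∀ j, w '' {s | s.1 = j} ⊆ B := by
      intro j
      have hj : a j ∈ X i := by
        by_cases hji : j = i
        · exact hji ▸ heX i
        · exact haX i j hji
      rw [hB] at hj
      have := mk_mem_inducedEdges.1 hj.1
      rintro _ ⟨⟨_, b⟩, rfl, rfl⟩
      cases b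
      exacts [this.2.1, this.2.2]
    have hci := hcX i
    rw [hB] at hci
    have hci' := mk_mem_inducedEdges.1 hci.1
    refine h2 i (hBic.prop.mono (p := v (i, false)) (q := v (i, true)) ?_ (by simp) (by simp)
      (hadj' i))
    rintro y (⟨s, rfl⟩ | (rfl | rfl))
    exacts [hall s.1 ⟨s, rfl, rfl⟩, hci'.2.1, hci'.2.2]
  · refine h2 i (inducesCompleteBipartite_range_union (hadj' i) fun l => ?_)
    obtain ⟨-, B, hBic, hB⟩ := (hX l).prop
    have hci := heX l
    rw [hB] at hci
    have hci' := mk_mem_inducedEdges.1 hci.1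
    refine hBic.prop.mono (p := v (i, false)) (q := v (i, true)) ?_ (by simp) (by simp) (hadj' i)
    refine Set.union_subset (image_endsExcept_subset (G := G) fun j hj => ?_) ?_
    · have := haX l j hj
      rw [hB] at this
      exact this.1
    · rintro y (rfl | rfl)
      exacts [hci'.2.1, hci'.2.2]

theorem not_isHereditaryHelly_iff [Finite V] :
    ¬ IsHereditaryHelly (edgeBicliqueHypergraph G) ↔
      ∃ x : Ends ⊕ Ends → V, HereditaryHellyObstruction (G.comap x) :=
  ⟨exists_hereditaryHellyObstruction, fun ⟨_, h⟩ => not_isHereditaryHelly_of_obstruction h⟩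

/-! ### From forbidden patterns to recognition -/

/-- Graph classes described by finitely many forbidden patterns on a fixed set of vertices can be
recognized in polynomial time. -/
theorem recognizable_of_not_iff_exists_comap {ι : Type*} [Fintype ι] [Nonempty ι]
    (C : SimpleGraph ι → Prop) (Q : InputGraph → Prop)
    (hQ : ∀ G : InputGraph, ¬ Q G ↔ ∃ x : ι → Fin G.1, C (G.2.comap x)) :
    RecognizableInPolyTime Q := by
  set e := Fintype.equivFin ι
  refine recognizable_of_not_iff_exists_tuple (Fintype.card_pos (α := ι))
    -- An arbitrary relation `M` need not be symmetric or irreflexive, so `C` is asked of a graph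
    -- with that adjacency.
    (fun M => ∃ H : SimpleGraph ι, C H ∧ ∀ s t, H.Adj s t ↔ M (e s) (e t)) Q fun G => ?_
  rw [hQ]
  constructor
  · rintro ⟨x, hx⟩
    exact ⟨x ∘ e.symm, _, hx, fun s t => by simp⟩
  · rintro ⟨x, H, hH, h⟩
    refine ⟨x ∘ e, ?_⟩
    convert hH
    ext s t
    simp [h]

end EdgeBiclique

theorem mainTheorem7 :
    EdgeBiclique.RecognizableInPolyTime (fun G =>
        EdgeBiclique.IsHereditaryHelly (EdgeBiclique.edgeBicliqueHypergraph G.2)) ∧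
      EdgeBiclique.RecognizableInPolyTime (fun G =>
        ∀ S : Set (Fin G.1),
          EdgeBiclique.IsHelly (EdgeBiclique.edgeBicliqueHypergraph (G.2.induce S))) :=
  ⟨EdgeBiclique.recognizable_of_not_iff_exists_comap EdgeBiclique.HereditaryHellyObstruction _
      fun _ => EdgeBiclique.not_isHereditaryHelly_iff,
    EdgeBiclique.recognizable_of_not_iff_exists_comap EdgeBiclique.HellyObstruction _
      fun _ => EdgeBiclique.not_forall_induce_isHelly_iff⟩
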